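/- Let $q\in L^1(\mathbb R)$ be real-valued and suppose that there is a constant $q_m\ge 0$ such that $q(x)+q_m e^{-x^2}\ge 0$ for almost every $x\in\mathbb R$. Let $H=-\frac{d^2}{dx^2}+V$, with $V(x)=x^2+q(x)$, be the operator on $L^2(\mathbb R)$ associated with the quadratic form $u\mapsto\int_{\mathbb R}(u')^2\,dx+\int_{\mathbb R}Vu^2\,dx$ on $H^1(\mathbb R)\cap L^2(\mathbb R,V(x)\,dx)$. Then the eigenvalues of $H$, repeated according to their (finite) multiplicities, form a sequence $\lambda_0\le\lambda_1\le\cdots\to\infty$, and, with $\lambda_k^0=2k+1$, $$\sum_{k=0}^{n}\left[\lambda_k-\lambda_k^0-\frac{1}{\pi\sqrt{\lambda_k^0}}\int_{\mathbb R}q(x)\,dx\right]\le\frac{\chi_n}{\pi}\int_{\mathbb R}q(x)\,dx+\varepsilon_n\frac{q_m}{\sqrt\pi},\qquad n=0,1,2,\ldots,$$ where $$\chi_n=\begin{cases}\dfrac{2n+3}{n+1}\,\dfrac{\Gamma(\frac n2+1)}{\Gamma(\frac{n+1}2)}-\displaystyle\sum_{k=0}^n\frac1{\sqrt{\lambda_k^0}},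 & n\text{ odd},\\[3mm](n+1)\,\dfrac{\Gamma(\frac{n+1}2)}{\Gamma(\frac n2+1)}-\displaystyle\sum_{k=0}^n\frac1{\sqrt{\lambda_k^0}}, & n\text{ even},\end{cases}\qquad \omega_n=\chi_n+\sum_{k=0}^n\frac1{\sqrt{\lambda_k^0}},$$ $$\varepsilon_n=\omega_n-\sqrt2\,\frac{\Gamma(n+\frac32)}{\Gamma(n+1)}.$$ Moreover $\varepsilon_n\ge 0$ for all $n\ge 0$, and $\varepsilon_n=O(1/\sqrt n)$ as $n\to\infty$. -/

import Mathlib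

open MeasureTheory Filter Topology Asymptotics
open scoped ContDiff

noncomputable section

namespace PerturbedOscillator

/-- The real Hilbert space `L²(ℝ)` with respect to Lebesgue measure. -/
abbrev L2 : Type := Lp ℝ 2 (volume : Measure ℝ)

/-- `g ∈ L²(ℝ)` is the weak derivative of `u ∈ L²(ℝ)`:
`∫ u φ' = -∫ g φ` for all real test functions `φ ∈ C_c^∞(ℝ)`.
A function `u ∈ L²(ℝ)` is in `H¹(ℝ)` iff such a `g` exists, and then `g` is unique. -/
def IsWeakDeriv (u g : L2) : Prop :=
  ∀ φ : ℝ → ℝ, ContDiff ℝ ∞ φ → HasCompactSupport φ →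
    ∫ x, u x * deriv φ x = -∫ x, g x * φ x

lemma integrable_mul_of_memLp (u : L2) {f : ℝ → ℝ} (hf : Continuous f)
    (hc : HasCompactSupport f) : Integrable (fun x => u x * f x) :=
  (Lp.memLp u).integrable_mul (q := 2) (hf.memLp_of_hasCompactSupport hc)

lemma integrable_mul_L2 (u v : L2) : Integrable (fun x => u x * v x) :=
  (Lp.memLp u).integrable_mul (q := 2) (Lp.memLp v)

lemma IsWeakDeriv.zero : IsWeakDeriv 0 0 := by
  intro φ _ _
  have h0 : ((0 : L2) : ℝ → ℝ) =ᵐ[volume] 0 := Lp.coeFn_zero ℝ 2 volume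
  have h1 : ∫ x, (0 : L2) x * deriv φ x = 0 := by
    rw [← integral_zero ℝ ℝ (μ := volume)]
    refine integral_congr_ae ?_
    filter_upwards [h0] with x hx
    simp
  have h2 : ∫ x, (0 : L2) x * φ x = 0 := by
    rw [← integral_zero ℝ ℝ (μ := volume)]
    refine integral_congr_ae ?_
    filter_upwards [h0] with x hx
    simp
  rw [h1, h2, neg_zero]

lemma IsWeakDeriv.add {u v g h : L2} (hu : IsWeakDeriv u g) (hv : IsWeakDeriv v h) :
    IsWeakDeriv (u + v) (g + h) := by
  intro φ hφ hc
  have hd : Continuous (deriv φ) := hφ.continuous_deriv (by simp)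
  have e1 : ∫ x, (u + v : L2) x * deriv φ x
      = (∫ x, u x * deriv φ x) + ∫ x, v x * deriv φ x := by
    rw [← integral_add (integrable_mul_of_memLp u hd hc.deriv)
      (integrable_mul_of_memLp v hd hc.deriv)]
    refine integral_congr_ae ?_
    filter_upwards [Lp.coeFn_add u v] with x hx
    simp only [hx, Pi.add_apply, add_mul]
  have e2 : ∫ x, (g + h : L2) x * φ x = (∫ x, g x * φ x) + ∫ x, h x * φ x := by
    rw [← integral_add (integrable_mul_of_memLp g hφ.continuous hc)
      (integrable_mul_of_memLp h hφ.continuous hc)]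
    refine integral_congr_ae ?_
    filter_upwards [Lp.coeFn_add g h] with x hx
    simp only [hx, Pi.add_apply, add_mul]
  rw [e1, e2, hu φ hφ hc, hv φ hφ hc]
  ring

lemma IsWeakDeriv.smul {u g : L2} (c : ℝ) (hu : IsWeakDeriv u g) :
    IsWeakDeriv (c • u) (c • g) := by
  intro φ hφ hc
  have e1 : ∫ x, (c • u : L2) x * deriv φ x = c * ∫ x, u x * deriv φ x := by
    rw [← integral_const_mul]
    refine integral_congr_ae ?_
    filter_upwards [Lp.coeFn_smul c u] with x hx
    simp [hx, mul_assoc]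
  have e2 : ∫ x, (c • g : L2) x * φ x = c * ∫ x, g x * φ x := by
    rw [← integral_const_mul]
    refine integral_congr_ae ?_
    filter_upwards [Lp.coeFn_smul c g] with x hx
    simp [hx, mul_assoc]
  rw [e1, e2, hu φ hφ hc]
  ring

lemma integrable_potential_mul {V u v : ℝ → ℝ} (mu : AEStronglyMeasurable u volume)
    (mv : AEStronglyMeasurable v volume) (hu : Integrable (fun x => V x * u x ^ 2))
    (hv : Integrable (fun x => V x * v x ^ 2)) : Integrable (fun x => V x * (u x * v x)) := by
  have hm : AEStronglyMeasurable (fun x => V x * (u x * v x)) volume := by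
    have h : AEMeasurable (fun x => (V x * u x ^ 2) * (v x / u x)) volume :=
      hu.aestronglyMeasurable.aemeasurable.mul (mv.aemeasurable.div mu.aemeasurable)
    refine h.aestronglyMeasurable.congr (Eventually.of_forall fun x => ?_)
    by_cases h0 : u x = 0
    · simp [h0]
    · simp only
      field_simp
  refine (hu.norm.add hv.norm).mono' hm (Eventually.of_forall fun x => ?_)
  simp only [Pi.add_apply, Real.norm_eq_abs, abs_mul, abs_pow]
  nlinarith [mul_nonneg (abs_nonneg (V x)) (sq_nonneg (|u x| - |v x|)),
    mul_nonneg (abs_nonneg (V x)) (add_nonneg (sq_nonneg |u x|) (sq_nonneg |v x|))]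

/-- The form domain `H¹(ℝ) ∩ L²(ℝ, V dx)` of `-d²/dx² + V`. -/
def formDomain (V : ℝ → ℝ) : Submodule ℝ L2 where
  carrier := {u | (∃ g : L2, IsWeakDeriv u g) ∧ Integrable (fun x => V x * u x ^ 2)}
  zero_mem' := by
    refine ⟨⟨0, IsWeakDeriv.zero⟩, ?_⟩
    refine (integrable_zero ℝ ℝ volume).congr ?_
    filter_upwards [Lp.coeFn_zero ℝ 2 (volume : Measure ℝ)] with x hx
    simp
  add_mem' := by
    rintro u v ⟨⟨g, hg⟩, hu⟩ ⟨⟨h, hh⟩, hv⟩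
    refine ⟨⟨g + h, hg.add hh⟩, ?_⟩
    have huv := integrable_potential_mul (Lp.aestronglyMeasurable u)
      (Lp.aestronglyMeasurable v) hu hv
    refine ((hu.add (huv.const_mul 2)).add hv).congr ?_
    filter_upwards [Lp.coeFn_add u v] with x hx
    simp only [Pi.add_apply, hx]
    ring
  smul_mem' := by
    rintro c u ⟨⟨g, hg⟩, hu⟩
    refine ⟨⟨c • g, hg.smul c⟩, ?_⟩
    refine (hu.const_mul (c ^ 2)).congr ?_
    filter_upwards [Lp.coeFn_smul c u] with x hx
    simp only [hx, Pi.smul_apply, smul_eq_mul]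
    ring

/-- The graph of the operator `H = -d²/dx² + V` on `L²(ℝ)`, as the operator associated with the
quadratic form `∫ (u')² + ∫ V u²` on `H¹(ℝ) ∩ L²(ℝ, V dx)`: the pair `(u, f)` lies in the graph
(that is, `u ∈ D(H)` and `H u = f`) iff `u` is in the form domain and
`∫ u' v' + ∫ V u v = ∫ f v` for every `v` in the form domain. -/
def schrodingerGraph (V : ℝ → ℝ) : Submodule ℝ (L2 × L2) where
  carrier := {p | p.1 ∈ formDomain V ∧ ∃ g : L2, IsWeakDeriv p.1 g ∧
    ∀ v ∈ formDomain V, ∀ h : L2, IsWeakDeriv v h →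
      (∫ x, g x * h x) + ∫ x, V x * (p.1 x * v x) = ∫ x, p.2 x * v x}
  zero_mem' := by
    refine ⟨(formDomain V).zero_mem, 0, IsWeakDeriv.zero, fun v _ h _ => ?_⟩
    have h0 : ((0 : L2) : ℝ → ℝ) =ᵐ[volume] 0 := Lp.coeFn_zero ℝ 2 volume
    have z : ∀ w : L2, ∫ x, (0 : L2) x * w x = 0 := fun w => by
      rw [← integral_zero ℝ ℝ (μ := volume)]
      refine integral_congr_ae ?_
      filter_upwards [h0] with x hx
      simp
    have z' : ∫ x, V x * ((0 : L2) x * v x) = 0 := by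
      rw [← integral_zero ℝ ℝ (μ := volume)]
      refine integral_congr_ae ?_
      filter_upwards [h0] with x hx
      simp
    simp only [Prod.fst_zero, Prod.snd_zero]
    rw [z h, z v, z', add_zero]
  add_mem' := by
    rintro ⟨u₁, f₁⟩ ⟨u₂, f₂⟩ ⟨m₁, g₁, d₁, e₁⟩ ⟨m₂, g₂, d₂, e₂⟩
    refine ⟨(formDomain V).add_mem m₁ m₂, g₁ + g₂, d₁.add d₂, fun v hv h hh => ?_⟩
    have a : ∀ p q w : L2, ∫ x, (p + q : L2) x * w x = (∫ x, p x * w x) + ∫ x, q x * w x :=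
      fun p q w => by
        rw [← integral_add (integrable_mul_L2 p w) (integrable_mul_L2 q w)]
        refine integral_congr_ae ?_
        filter_upwards [Lp.coeFn_add p q] with x hx
        simp only [hx, Pi.add_apply, add_mul]
    have a' : ∫ x, V x * ((u₁ + u₂ : L2) x * v x)
        = (∫ x, V x * (u₁ x * v x)) + ∫ x, V x * (u₂ x * v x) := by
      rw [← integral_add
        (integrable_potential_mul (Lp.aestronglyMeasurable u₁) (Lp.aestronglyMeasurable v)
          m₁.2 hv.2)
        (integrable_potential_mul (Lp.aestronglyMeasurable u₂) (Lp.aestronglyMeasurable v)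
          m₂.2 hv.2)]
      refine integral_congr_ae ?_
      filter_upwards [Lp.coeFn_add u₁ u₂] with x hx
      simp only [hx, Pi.add_apply]
      ring
    have E₁ := e₁ v hv h hh
    have E₂ := e₂ v hv h hh
    simp only [Prod.mk_add_mk] at E₁ E₂ ⊢
    rw [a g₁ g₂ h, a f₁ f₂ v, a']
    linarith
  smul_mem' := by
    rintro c ⟨u, f⟩ ⟨m, g, d, e⟩
    refine ⟨(formDomain V).smul_mem c m, c • g, d.smul c, fun v hv h hh => ?_⟩
    have a : ∀ p w : L2, ∫ x, (c • p : L2) x * w x = c * ∫ x, p x * w x := fun p w => by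
      rw [← integral_const_mul]
      refine integral_congr_ae ?_
      filter_upwards [Lp.coeFn_smul c p] with x hx
      simp [hx, mul_assoc]
    have a' : ∫ x, V x * ((c • u : L2) x * v x) = c * ∫ x, V x * (u x * v x) := by
      rw [← integral_const_mul]
      refine integral_congr_ae ?_
      filter_upwards [Lp.coeFn_smul c u] with x hx
      simp only [hx, Pi.smul_apply, smul_eq_mul]
      ring
    have E := e v hv h hh
    simp only [Prod.smul_mk] at E ⊢
    rw [a g h, a f v, a', ← E]
    ring

/-- The eigenspace `{u ∈ D(H) | H u = μ u}` of `H = -d²/dx² + V`. -/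
def eigenspace (V : ℝ → ℝ) (μ : ℝ) : Submodule ℝ L2 :=
  (schrodingerGraph V).comap (LinearMap.prod LinearMap.id (μ • LinearMap.id))

/-- `lam 0 ≤ lam 1 ≤ ⋯ → ∞` is the sequence of all eigenvalues of `-d²/dx² + V` on `L²(ℝ)`, each
repeated according to its multiplicity. -/
structure IsEigenvalueSequence (V : ℝ → ℝ) (lam : ℕ → ℝ) : Prop where
  monotone : Monotone lam
  tendsto : Tendsto lam atTop atTop
  finiteDimensional : ∀ μ : ℝ, FiniteDimensional ℝ (eigenspace V μ)
  multiplicity : ∀ μ : ℝ, Module.finrank ℝ (eigenspace V μ) = {k : ℕ | lam k = μ}.ncard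

/-- The eigenvalues `2k + 1` of the unperturbed harmonic oscillator. -/
def lam0 (k : ℕ) : ℝ := 2 * (k : ℝ) + 1

def chi (n : ℕ) : ℝ :=
  if Odd n then
    (2 * (n : ℝ) + 3) / ((n : ℝ) + 1) * (Real.Gamma ((n : ℝ) / 2 + 1)
        / Real.Gamma (((n : ℝ) + 1) / 2))
      - ∑ k ∈ Finset.range (n + 1), 1 / √(lam0 k)
  else
    ((n : ℝ) + 1) * (Real.Gamma (((n : ℝ) + 1) / 2) / Real.Gamma ((n : ℝ) / 2 + 1))
      - ∑ k ∈ Finset.range (n + 1), 1 / √(lam0 k)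

def omega (n : ℕ) : ℝ := chi n + ∑ k ∈ Finset.range (n + 1), 1 / √(lam0 k)

def epsilon (n : ℕ) : ℝ :=
  omega n - √2 * (Real.Gamma ((n : ℝ) + 3 / 2) / Real.Gamma ((n : ℝ) + 1))

end PerturbedOscillator

end

/-!
The Hermite functions `ψ₀, …, ψₙ` are trial functions in Ky Fan's variational principle: the
sum of the first `n + 1` eigenvalues is at most the sum of the energies `2k + 1 + ∫ q ψₖ²`. The
density `∑ ψₖ²` is bounded pointwise by `ωₙ / π`: adding `ψₙ₊₁²` to the Christoffel–Darboux
expression for `2 ∑ ψₖ²` gives a function that is monotone on each half line (as in Sonin's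
theorem), hence maximal at the origin, where it equals `2 ωₙ / π`. Applied to the nonnegative
function `q(x) + q_m exp(-x²)`, this bounds `∑ ∫ (q + q_m exp(-x²)) ψₖ²`, and the Gaussian
integrals `∑ ∫ exp(-x²) ψₖ²`, which are known in closed form, are subtracted.
-/

noncomputable section

namespace PerturbedOscillator

open Polynomial

/-! ### Hermite polynomials -/

/-- The Hermite polynomials in the physicists' normalization: leading coefficient `2 ^ n`,
orthogonal for the weight `exp (-x ^ 2)`. Mathlib's `Polynomial.hermite` is the probabilists'
family, orthogonal for `exp (-x ^ 2 / 2)`. -/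
def hermitePoly : ℕ → ℝ[X]
  | 0 => 1
  | n + 1 => 2 * X * hermitePoly n - derivative (hermitePoly n)

lemma hermitePoly_succ (n : ℕ) :
    hermitePoly (n + 1) = 2 * X * hermitePoly n - derivative (hermitePoly n) := rfl

lemma derivative_hermitePoly_succ (n : ℕ) :
    derivative (hermitePoly (n + 1)) = (2 * ((n : ℝ) + 1)) • hermitePoly n := by
  induction n with
  | zero => simp [hermitePoly, smul_eq_C_mul, C_ofNat]
  | succ n ih =>
    rw [hermitePoly_succ (n + 1), derivative_sub, derivative_mul, ih, derivative_smul]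
    simp only [derivative_mul, derivative_ofNat, derivative_X, hermitePoly_succ n, smul_eq_C_mul,
      C_mul, C_add, C_ofNat, C_1, map_natCast]
    push_cast
    ring

lemma degree_hermitePoly (n : ℕ) : (hermitePoly n).degree = n := by
  induction n with
  | zero => exact degree_one
  | succ n ih =>
    have degree_two_X_mul : (2 * X * hermitePoly n).degree = ((n + 1 : ℕ) : WithBot ℕ) := by
      rw [degree_mul, ih, ← C_ofNat, degree_C_mul_X two_ne_zero]
      push_cast
      exact add_comm _ _
    rw [hermitePoly_succ, degree_sub_eq_left_of_degree_lt, degree_two_X_mul]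
    rw [degree_two_X_mul]
    exact (degree_derivative_le.trans_eq ih).trans_lt (mod_cast n.lt_succ_self)

lemma span_range_hermitePoly : Submodule.span ℝ (Set.range hermitePoly) = ⊤ :=
  Sequence.span ⟨hermitePoly, degree_hermitePoly⟩ fun n =>
    (leadingCoeff_ne_zero.2 (Sequence.ne_zero ⟨hermitePoly, degree_hermitePoly⟩ n)).isUnit

/-! ### Gaussian integrals of polynomials -/

lemma integrable_eval_mul_exp {b : ℝ} (hb : 0 < b) (p : ℝ[X]) :
    Integrable (fun x : ℝ => p.eval x * Real.exp (-b * x ^ 2)) := by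
  induction p using Polynomial.induction_on' with
  | add p r hp hr => simpa only [eval_add, add_mul] using! hp.add hr
  | monomial n a =>
    have integrable_pow_mul_exp :=
      integrable_rpow_mul_exp_neg_mul_sq hb (s := n) (neg_one_lt_zero.trans_le n.cast_nonneg)
    simpa only [eval_monomial, mul_assoc, Real.rpow_natCast]
      using integrable_pow_mul_exp.const_mul a

lemma hasDerivAt_eval_mul_exp (b : ℝ) (p : ℝ[X]) (x : ℝ) :
    HasDerivAt (fun x : ℝ => p.eval x * Real.exp (-b * x ^ 2))
      ((derivative p - (2 * b) • (X * p)).eval x * Real.exp (-b * x ^ 2)) x := by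
  have hasDerivAt_exponent : HasDerivAt (fun x : ℝ => -b * x ^ 2) (-b * (2 * x)) x := by
    simpa using (hasDerivAt_pow 2 x).const_mul (-b)
  refine ((p.hasDerivAt x).mul hasDerivAt_exponent.exp).congr_deriv ?_
  simp only [eval_sub, eval_smul, eval_mul, eval_X, smul_eq_mul]
  ring

/-- The linear functional `p ↦ ∫ p(x) exp (-b x²) dx` on polynomials. -/
def gaussIntegral {b : ℝ} (hb : 0 < b) : ℝ[X] →ₗ[ℝ] ℝ where
  toFun p := ∫ x : ℝ, p.eval x * Real.exp (-b * x ^ 2)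
  map_add' p r := by
    simp only [eval_add, add_mul]
    exact integral_add (integrable_eval_mul_exp hb p) (integrable_eval_mul_exp hb r)
  map_smul' a p := by
    simp only [eval_smul, smul_eq_mul, mul_assoc, integral_const_mul, RingHom.id_apply]

lemma gaussIntegral_apply {b : ℝ} (hb : 0 < b) (p : ℝ[X]) :
    gaussIntegral hb p = ∫ x : ℝ, p.eval x * Real.exp (-b * x ^ 2) := rfl

lemma gaussIntegral_one {b : ℝ} (hb : 0 < b) : gaussIntegral hb 1 = √(Real.pi / b) := by
  simpa only [gaussIntegral_apply, eval_one, one_mul] using integral_gaussian b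

lemma gaussIntegral_derivative {b : ℝ} (hb : 0 < b) (p : ℝ[X]) :
    gaussIntegral hb (derivative p) = 2 * b * gaussIntegral hb (X * p) := by
  have integral_deriv_eq_zero : gaussIntegral hb (derivative p - (2 * b) • (X * p)) = 0 :=
    integral_eq_zero_of_hasDerivAt_of_integrable (hasDerivAt_eval_mul_exp b p)
      (integrable_eval_mul_exp hb _) (integrable_eval_mul_exp hb _)
  rwa [map_sub, map_smul, smul_eq_mul, sub_eq_zero] at integral_deriv_eq_zero

lemma gaussIntegral_hermitePoly_succ_mul (n : ℕ) (p : ℝ[X]) :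
    gaussIntegral one_pos (hermitePoly (n + 1) * p)
      = gaussIntegral one_pos (hermitePoly n * derivative p) := by
  have integration_by_parts := gaussIntegral_derivative one_pos (hermitePoly n * p)
  have succ_mul : hermitePoly (n + 1) * p
      = (2 : ℝ) • (X * (hermitePoly n * p)) - derivative (hermitePoly n) * p := by
    rw [hermitePoly_succ, smul_eq_C_mul, C_ofNat]
    ring
  rw [derivative_mul, map_add] at integration_by_parts
  rw [succ_mul, map_sub, map_smul, smul_eq_mul]
  linarith

lemma gaussIntegral_hermitePoly_mul_hermitePoly (m n : ℕ) :
    gaussIntegral one_pos (hermitePoly m * hermitePoly n)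
      = if m = n then 2 ^ n * n.factorial * √Real.pi else 0 := by
  induction m generalizing n with
  | zero =>
    cases n with
    | zero => simp [hermitePoly, gaussIntegral_one]
    | succ n =>
      rw [mul_comm, gaussIntegral_hermitePoly_succ_mul]
      simp [hermitePoly]
  | succ m ih =>
    rw [gaussIntegral_hermitePoly_succ_mul]
    cases n with
    | zero => simp [hermitePoly]
    | succ n =>
      rw [derivative_hermitePoly_succ, mul_smul_comm, map_smul, ih, smul_eq_mul, mul_ite, mul_zero]
      simp only [add_left_inj, Nat.factorial_succ]
      push_cast
      ring_nf

lemma Gamma_add_three_halves {x : ℝ} (hx : 0 ≤ x) :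
    Real.Gamma (x + 3 / 2) = (x + 1 / 2) * Real.Gamma (x + 1 / 2) := by
  rw [← Real.Gamma_add_one (by positivity)]
  ring_nf

lemma gaussIntegral_two_hermitePoly_sq (n : ℕ) :
    gaussIntegral two_pos (hermitePoly n ^ 2) = 2 ^ n * Real.Gamma (n + 1 / 2) / √2 := by
  induction n with
  | zero =>
    simp only [hermitePoly, one_pow, gaussIntegral_one, Real.sqrt_div Real.pi_pos.le, pow_zero,
      one_mul, Nat.cast_zero, zero_add, Real.Gamma_one_half_eq]
  | succ n ih =>
    -- The two total derivatives differ by `(2n + 1) H_n² - H_{n+1}²` modulo `exp (-2x²)`.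
    have parts_mul_succ := gaussIntegral_derivative two_pos (hermitePoly n * hermitePoly (n + 1))
    have parts_X_mul_sq := gaussIntegral_derivative two_pos (X * hermitePoly n ^ 2)
    have combination :
        derivative (hermitePoly n * hermitePoly (n + 1))
          - (4 : ℝ) • (X * (hermitePoly n * hermitePoly (n + 1)))
          - (derivative (X * hermitePoly n ^ 2) - (4 : ℝ) • (X * (X * hermitePoly n ^ 2)))
        = (2 * (n : ℝ) + 1) • hermitePoly n ^ 2 - hermitePoly (n + 1) ^ 2 := by
      rw [derivative_mul, derivative_mul, derivative_pow, derivative_hermitePoly_succ,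
        hermitePoly_succ]
      simp only [derivative_X, smul_eq_C_mul, C_mul, C_add, C_ofNat, C_1, map_natCast]
      push_cast
      ring
    have recurrence := congrArg (gaussIntegral two_pos) combination
    simp only [map_sub, map_smul, smul_eq_mul, parts_mul_succ, parts_X_mul_sq, ih] at recurrence
    rw [show ((n + 1 : ℕ) : ℝ) + 1 / 2 = n + 3 / 2 by push_cast; ring,
      Gamma_add_three_halves n.cast_nonneg]
    linear_combination recurrence

/-! ### Hermite functions -/

/-- The linear map taking a polynomial `p` to the function `p(x) exp (-x² / 2)`. -/
def gaussPoly : ℝ[X] →ₗ[ℝ] ℝ → ℝ where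
  toFun p x := p.eval x * Real.exp (-(1 / 2 : ℝ) * x ^ 2)
  map_add' p r := by
    ext x
    simp only [eval_add, add_mul, Pi.add_apply]
  map_smul' a p := by
    ext x
    simp only [eval_smul, smul_eq_mul, mul_assoc, RingHom.id_apply, Pi.smul_apply]

lemma gaussPoly_apply (p : ℝ[X]) (x : ℝ) :
    gaussPoly p x = p.eval x * Real.exp (-(1 / 2 : ℝ) * x ^ 2) := rfl

lemma gaussPoly_X_mul (p : ℝ[X]) (x : ℝ) : gaussPoly (X * p) x = x * gaussPoly p x := by
  simp only [gaussPoly_apply, eval_mul, eval_X, mul_assoc]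

lemma hasDerivAt_gaussPoly (p : ℝ[X]) (x : ℝ) :
    HasDerivAt (gaussPoly p) (gaussPoly (derivative p - X * p) x) x := by
  simpa only [mul_one_div_cancel (two_ne_zero' ℝ), one_smul]
    using! hasDerivAt_eval_mul_exp (1 / 2) p x

lemma contDiff_gaussPoly (p : ℝ[X]) : ContDiff ℝ ∞ (gaussPoly p) :=
  ContDiff.mul (by simpa only [coe_aeval_eq_eval] using p.contDiff_aeval (𝕜 := ℝ) (R := ℝ) ∞)
    (by fun_prop)

lemma continuous_gaussPoly (p : ℝ[X]) : Continuous (gaussPoly p) :=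
  (contDiff_gaussPoly p).continuous

lemma gaussPoly_mul_gaussPoly (p r : ℝ[X]) (x : ℝ) :
    gaussPoly p x * gaussPoly r x = (p * r).eval x * Real.exp (-1 * x ^ 2) := by
  rw [gaussPoly_apply, gaussPoly_apply, eval_mul, mul_mul_mul_comm, ← Real.exp_add]
  ring_nf

lemma integrable_gaussPoly_mul (p r : ℝ[X]) :
    Integrable (fun x => gaussPoly p x * gaussPoly r x) := by
  simpa only [gaussPoly_mul_gaussPoly] using integrable_eval_mul_exp one_pos (p * r)

lemma integral_gaussPoly_mul (p r : ℝ[X]) :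
    ∫ x, gaussPoly p x * gaussPoly r x = gaussIntegral one_pos (p * r) := by
  simp only [gaussPoly_mul_gaussPoly, gaussIntegral_apply]

lemma memLp_gaussPoly (p : ℝ[X]) : MemLp (gaussPoly p) 2 volume := by
  rw [memLp_two_iff_integrable_sq (continuous_gaussPoly p).aestronglyMeasurable]
  simpa only [sq] using integrable_gaussPoly_mul p p

/-- The constant normalizing the `n`-th Hermite function in `L²(ℝ)`. -/
def hermiteConst (n : ℕ) : ℝ := 1 / √(2 ^ n * n.factorial * √Real.pi)

lemma hermiteConst_pos (n : ℕ) : 0 < hermiteConst n := by unfold hermiteConst; positivity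

lemma hermiteConst_sq (n : ℕ) : hermiteConst n ^ 2 = 1 / (2 ^ n * n.factorial * √Real.pi) := by
  rw [hermiteConst, div_pow, Real.sq_sqrt (by positivity), one_pow]

/-- The coefficient `√(2(n + 1))` in the relations between the `n`-th and the `n + 1`-st Hermite
function. -/
def ladder (n : ℕ) : ℝ := √(2 * ((n : ℝ) + 1))

lemma ladder_sq (n : ℕ) : ladder n ^ 2 = 2 * ((n : ℝ) + 1) := Real.sq_sqrt (by positivity)

lemma ladder_pos (n : ℕ) : 0 < ladder n := by unfold ladder; positivity

lemma ladder_mul_hermiteConst_succ (n : ℕ) :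
    ladder n * hermiteConst (n + 1) = hermiteConst n := by
  have radicand_succ : (2 : ℝ) ^ (n + 1) * (n + 1).factorial * √Real.pi
      = (2 * ((n : ℝ) + 1)) * (2 ^ n * n.factorial * √Real.pi) := by
    rw [Nat.factorial_succ]
    push_cast
    ring
  have ladder_ne_zero := (ladder_pos n).ne'
  rw [hermiteConst, radicand_succ, Real.sqrt_mul (by positivity), ← ladder, hermiteConst]
  field_simp

/-- The `n`-th Hermite polynomial, normalized for the weight `exp (-x ^ 2)`. -/
def normHermitePoly (n : ℕ) : ℝ[X] := hermiteConst n • hermitePoly n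

lemma derivative_normHermitePoly_succ (n : ℕ) :
    derivative (normHermitePoly (n + 1)) = ladder n • normHermitePoly n := by
  rw [normHermitePoly, normHermitePoly, derivative_smul, derivative_hermitePoly_succ, ← ladder_sq,
    smul_smul, smul_smul, ← ladder_mul_hermiteConst_succ n]
  ring_nf

lemma ladder_smul_normHermitePoly_succ (n : ℕ) :
    ladder n • normHermitePoly (n + 1)
      = (2 : ℝ) • (X * normHermitePoly n) - derivative (normHermitePoly n) := by
  rw [normHermitePoly, normHermitePoly, smul_smul, ladder_mul_hermiteConst_succ, hermitePoly_succ,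
    derivative_smul, mul_smul_comm, smul_comm (2 : ℝ), smul_sub, mul_assoc, smul_eq_C_mul (2 : ℝ),
    C_ofNat]

/-- The `n`-th Hermite function, normalized in `L²(ℝ)`. -/
def hermiteFun (n : ℕ) : ℝ → ℝ := gaussPoly (normHermitePoly n)

lemma hermiteFun_zero_apply (x : ℝ) :
    hermiteFun 0 x = hermiteConst 0 * Real.exp (-(1 / 2 : ℝ) * x ^ 2) := by
  simp only [hermiteFun, normHermitePoly, hermitePoly, gaussPoly_apply, eval_smul, eval_one,
    smul_eq_mul, mul_one]

lemma continuous_hermiteFun (n : ℕ) : Continuous (hermiteFun n) := continuous_gaussPoly _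

lemma hasDerivAt_hermiteFun (n : ℕ) (x : ℝ) :
    HasDerivAt (hermiteFun n) (x * hermiteFun n x - ladder n * hermiteFun (n + 1) x) x := by
  have ladder_mul_succ := congrArg (gaussPoly · x) (ladder_smul_normHermitePoly_succ n)
  simp only [map_sub, map_smul, Pi.sub_apply, Pi.smul_apply, smul_eq_mul, gaussPoly_X_mul]
    at ladder_mul_succ
  refine (hasDerivAt_gaussPoly _ x).congr_deriv ?_
  rw [map_sub, Pi.sub_apply, gaussPoly_X_mul]
  unfold hermiteFun
  linarith

lemma hasDerivAt_hermiteFun_succ (n : ℕ) (x : ℝ) :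
    HasDerivAt (hermiteFun (n + 1))
      (ladder n * hermiteFun n x - x * hermiteFun (n + 1) x) x := by
  refine (hasDerivAt_gaussPoly _ x).congr_deriv ?_
  rw [derivative_normHermitePoly_succ, map_sub, map_smul, Pi.sub_apply, gaussPoly_X_mul]
  rfl

lemma hermiteFun_one (x : ℝ) : ladder 0 * hermiteFun 1 x = 2 * x * hermiteFun 0 x := by
  have deriv_gaussian := (hasDerivAt_gaussPoly (normHermitePoly 0) x).unique
    (hasDerivAt_hermiteFun 0 x)
  have derivative_zero : derivative (normHermitePoly 0) = 0 := by
    simp [normHermitePoly, hermitePoly]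
  rw [derivative_zero, zero_sub, map_neg, Pi.neg_apply, gaussPoly_X_mul] at deriv_gaussian
  change -(x * hermiteFun 0 x) = _ at deriv_gaussian
  linarith

lemma hermiteFun_recurrence (n : ℕ) (x : ℝ) :
    ladder (n + 1) * hermiteFun (n + 2) x
      = 2 * x * hermiteFun (n + 1) x - ladder n * hermiteFun n x := by
  have eq_derivs := (hasDerivAt_hermiteFun (n + 1) x).unique (hasDerivAt_hermiteFun_succ n x)
  linarith

lemma integral_hermiteFun_mul_hermiteFun (m n : ℕ) :
    ∫ x, hermiteFun m x * hermiteFun n x = if m = n then 1 else 0 := by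
  unfold hermiteFun
  rw [integral_gaussPoly_mul, normHermitePoly, normHermitePoly, smul_mul_smul_comm, map_smul,
    gaussIntegral_hermitePoly_mul_hermitePoly, smul_eq_mul, mul_ite, mul_zero]
  split_ifs with h
  · rw [h, ← sq, hermiteConst_sq]
    field_simp
  · rfl

lemma integral_exp_mul_hermiteFun_sq (n : ℕ) :
    ∫ x, Real.exp (-x ^ 2) * hermiteFun n x ^ 2
      = Real.Gamma (n + 1 / 2) / (n.factorial * √2 * √Real.pi) := by
  have integrand_eq (x : ℝ) : Real.exp (-x ^ 2) * hermiteFun n x ^ 2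
      = (hermiteConst n ^ 2 • hermitePoly n ^ 2).eval x * Real.exp (-2 * x ^ 2) := by
    have exp_split : Real.exp (-2 * x ^ 2) = Real.exp (-x ^ 2) * Real.exp (-1 * x ^ 2) := by
      rw [← Real.exp_add]
      ring_nf
    rw [sq (hermiteFun n x), hermiteFun, gaussPoly_mul_gaussPoly, ← sq, normHermitePoly,
      _root_.smul_pow, exp_split]
    ring
  simp only [integrand_eq]
  rw [← gaussIntegral_apply two_pos, map_smul, gaussIntegral_two_hermitePoly_sq, hermiteConst_sq,
    smul_eq_mul]
  field_simp

/-! ### A uniform bound for the sum of squares of Hermite functions -/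

lemma two_mul_sum_hermiteFun_sq (n : ℕ) (x : ℝ) :
    2 * ∑ k ∈ Finset.range (n + 1), hermiteFun k x ^ 2
      = ladder n ^ 2 * (hermiteFun n x ^ 2 + hermiteFun (n + 1) x ^ 2)
        - 2 * ladder n * x * (hermiteFun n x * hermiteFun (n + 1) x) := by
  induction n with
  | zero =>
    have ladder_zero_sq := ladder_sq 0
    rw [Nat.cast_zero] at ladder_zero_sq
    rw [zero_add, Finset.range_one, Finset.sum_singleton]
    linear_combination
      (-hermiteFun 0 x ^ 2) * ladder_zero_sq - (ladder 0 * hermiteFun 1 x) * hermiteFun_one x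
  | succ n ih =>
    have ladder_succ_sq := ladder_sq (n + 1)
    push_cast at ladder_succ_sq
    rw [Finset.sum_range_succ, mul_add, ih]
    linear_combination (hermiteFun (n + 1) x ^ 2) * (ladder_sq n - ladder_succ_sq)
      - (ladder (n + 1) * hermiteFun (n + 2) x - ladder n * hermiteFun n x)
        * hermiteFun_recurrence n x

/-- A Sonin-type majorant of `2 ∑_{k ≤ n} ψ_k²`: adding `ψ_{n+1}²` to the Christoffel–Darboux
expression for that sum makes it monotone on either side of `0`. -/
def soninMajorant (n : ℕ) (x : ℝ) : ℝ :=
  ladder n ^ 2 * (hermiteFun n x ^ 2 + hermiteFun (n + 1) x ^ 2)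
    - 2 * ladder n * x * (hermiteFun n x * hermiteFun (n + 1) x) + hermiteFun (n + 1) x ^ 2

lemma two_mul_sum_hermiteFun_sq_le_soninMajorant (n : ℕ) (x : ℝ) :
    2 * ∑ k ∈ Finset.range (n + 1), hermiteFun k x ^ 2 ≤ soninMajorant n x :=
  (two_mul_sum_hermiteFun_sq n x).trans_le (le_add_of_nonneg_right (sq_nonneg _))

lemma hasDerivAt_soninMajorant (n : ℕ) (x : ℝ) :
    HasDerivAt (soninMajorant n) (-x * (2 * hermiteFun (n + 1) x ^ 2)) x := by
  have deriv_n := hasDerivAt_hermiteFun n x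
  have deriv_succ := hasDerivAt_hermiteFun_succ n x
  refine (((((deriv_n.pow 2).add (deriv_succ.pow 2)).const_mul (ladder n ^ 2)).sub
    (((hasDerivAt_id x).const_mul (2 * ladder n)).mul (deriv_n.mul deriv_succ))).add
      (deriv_succ.pow 2)).congr_deriv ?_
  simp only [Pi.mul_apply, id_eq, Nat.cast_ofNat, Nat.add_one_sub_one, pow_one, mul_one]
  ring

lemma le_apply_zero_of_hasDerivAt_neg_mul {f g : ℝ → ℝ}
    (hf : ∀ x, HasDerivAt f (-x * g x) x) (hg : ∀ x, 0 ≤ g x) (x : ℝ) : f x ≤ f 0 := by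
  have f_continuous : Continuous f := continuous_iff_continuousAt.2 fun y => (hf y).continuousAt
  rcases le_total 0 x with hx | hx
  · refine antitoneOn_of_hasDerivWithinAt_nonpos (convex_Ici 0) f_continuous.continuousOn
      (fun y _ => (hf y).hasDerivWithinAt) (fun y hy => ?_) Set.self_mem_Ici hx hx
    rw [interior_Ici] at hy
    exact mul_nonpos_of_nonpos_of_nonneg (neg_nonpos.2 hy.le) (hg y)
  · refine monotoneOn_of_hasDerivWithinAt_nonneg (convex_Iic 0) f_continuous.continuousOn
      (fun y _ => (hf y).hasDerivWithinAt) (fun y hy => ?_) hx Set.self_mem_Iic hx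
    rw [interior_Iic] at hy
    exact mul_nonneg (neg_nonneg.2 hy.le) (hg y)

lemma hermiteFun_odd_apply_zero (m : ℕ) : hermiteFun (2 * m + 1) 0 = 0 := by
  have eq_zero_of_ladder_mul {n : ℕ} (h : ladder n * hermiteFun (n + 1) 0 = 0) :
      hermiteFun (n + 1) 0 = 0 :=
    (mul_eq_zero.1 h).resolve_left (ladder_pos n).ne'
  induction m with
  | zero => exact eq_zero_of_ladder_mul (by rw [hermiteFun_one, mul_zero, zero_mul])
  | succ m ih =>
    exact eq_zero_of_ladder_mul <| by
      rw [show 2 * (m + 1) = 2 * m + 1 + 1 by ring, hermiteFun_recurrence, ih, mul_zero, mul_zero,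
        zero_mul, sub_zero]

lemma hermiteFun_even_apply_zero_sq (m : ℕ) :
    hermiteFun (2 * m) 0 ^ 2 = Real.Gamma (m + 1 / 2) / (Real.pi * m.factorial) := by
  have pi_ne_zero := Real.pi_ne_zero
  induction m with
  | zero =>
    have sqrt_pi_sq : √Real.pi ^ 2 = Real.pi := Real.sq_sqrt Real.pi_pos.le
    rw [mul_zero, hermiteFun_zero_apply, mul_pow, hermiteConst_sq, Nat.cast_zero, zero_add,
      Real.Gamma_one_half_eq]
    simp only [pow_zero, Nat.factorial_zero, Nat.cast_one, mul_one, one_mul, one_div, ne_eq,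
      OfNat.ofNat_ne_zero, not_false_eq_true, zero_pow, mul_zero, Real.exp_zero, one_pow]
    field_simp
    exact sqrt_pi_sq.symm
  | succ m ih =>
    have recurrence_sq : ladder (2 * m + 1) ^ 2 * hermiteFun (2 * (m + 1)) 0 ^ 2
        = ladder (2 * m) ^ 2 * hermiteFun (2 * m) 0 ^ 2 := by
      rw [← mul_pow, ← mul_pow, show 2 * (m + 1) = 2 * m + 2 by ring, hermiteFun_recurrence]
      ring
    rw [ladder_sq, ladder_sq, ih] at recurrence_sq
    rw [show ((m + 1 : ℕ) : ℝ) + 1 / 2 = m + 3 / 2 by push_cast; ring,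
      Gamma_add_three_halves m.cast_nonneg, Nat.factorial_succ]
    push_cast at recurrence_sq ⊢
    field_simp at recurrence_sq ⊢
    linear_combination recurrence_sq

lemma omega_of_odd {n : ℕ} (h : Odd n) :
    omega n = (2 * (n : ℝ) + 3) / ((n : ℝ) + 1) * (Real.Gamma ((n : ℝ) / 2 + 1)
        / Real.Gamma (((n : ℝ) + 1) / 2)) := by
  rw [omega, chi, if_pos h, sub_add_cancel]

lemma omega_of_not_odd {n : ℕ} (h : ¬Odd n) :
    omega n = ((n : ℝ) + 1) * (Real.Gamma (((n : ℝ) + 1) / 2) / Real.Gamma ((n : ℝ) / 2 + 1)) := by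
  rw [omega, chi, if_neg h, sub_add_cancel]

lemma soninMajorant_apply_zero (n : ℕ) : soninMajorant n 0 = 2 * (omega n / Real.pi) := by
  have pi_ne_zero := Real.pi_ne_zero
  rcases Nat.even_or_odd' n with ⟨m, rfl | rfl⟩
  · rw [omega_of_not_odd (by simp), soninMajorant, hermiteFun_odd_apply_zero,
      hermiteFun_even_apply_zero_sq, ladder_sq]
    push_cast
    rw [show (2 * (m : ℝ) + 1) / 2 = m + 1 / 2 by ring,
      show 2 * (m : ℝ) / 2 + 1 = m + 1 by ring, Real.Gamma_nat_eq_factorial]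
    field_simp
    ring
  · rw [omega_of_odd ⟨m, rfl⟩, soninMajorant, hermiteFun_odd_apply_zero,
      show 2 * m + 1 + 1 = 2 * (m + 1) by ring, hermiteFun_even_apply_zero_sq, ladder_sq,
      Nat.factorial_succ]
    push_cast
    rw [show (2 * (m : ℝ) + 1 + 1) / 2 = m + 1 by ring, Real.Gamma_nat_eq_factorial,
      show (2 * (m : ℝ) + 1) / 2 + 1 = m + 1 + 1 / 2 by ring]
    field_simp
    ring

lemma sum_hermiteFun_sq_le (n : ℕ) (x : ℝ) :
    ∑ k ∈ Finset.range (n + 1), hermiteFun k x ^ 2 ≤ omega n / Real.pi := by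
  refine le_of_mul_le_mul_left ?_ (zero_lt_two' ℝ)
  calc 2 * ∑ k ∈ Finset.range (n + 1), hermiteFun k x ^ 2
      ≤ soninMajorant n x := two_mul_sum_hermiteFun_sq_le_soninMajorant n x
    _ ≤ soninMajorant n 0 := le_apply_zero_of_hasDerivAt_neg_mul (hasDerivAt_soninMajorant n)
        (fun _ => by positivity) x
    _ = 2 * (omega n / Real.pi) := soninMajorant_apply_zero n

/-! ### Integrals against squares of Hermite functions -/

lemma integrable_mul_hermiteFun_sq {g : ℝ → ℝ} (hg : Integrable g) (n : ℕ) :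
    Integrable fun x => g x * hermiteFun n x ^ 2 := by
  refine hg.mul_bdd (c := omega n / Real.pi)
    ((continuous_hermiteFun n).pow 2).aestronglyMeasurable (Eventually.of_forall fun x => ?_)
  rw [Real.norm_of_nonneg (sq_nonneg _)]
  exact (Finset.single_le_sum (f := fun k => hermiteFun k x ^ 2) (fun k _ => sq_nonneg _)
    (Finset.self_mem_range_succ n)).trans (sum_hermiteFun_sq_le n x)

lemma sum_integral_mul_hermiteFun_sq_le {g : ℝ → ℝ} (hg : Integrable g)
    (g_nonneg : ∀ᵐ x, 0 ≤ g x) (n : ℕ) :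
    ∑ k ∈ Finset.range (n + 1), ∫ x, g x * hermiteFun k x ^ 2
      ≤ omega n / Real.pi * ∫ x, g x := by
  rw [← integral_finsetSum _ fun k _ => integrable_mul_hermiteFun_sq hg k, mul_comm,
    ← integral_mul_const]
  refine integral_mono_ae (integrable_finsetSum _ fun k _ => integrable_mul_hermiteFun_sq hg k)
    (hg.mul_const _) ?_
  filter_upwards [g_nonneg] with x gx_nonneg
  simp only [← Finset.mul_sum]
  exact mul_le_mul_of_nonneg_left (sum_hermiteFun_sq_le n x) gx_nonneg

lemma sum_integral_exp_mul_hermiteFun_sq (n : ℕ) :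
    ∑ k ∈ Finset.range (n + 1), ∫ x, Real.exp (-x ^ 2) * hermiteFun k x ^ 2
      = √2 * (Real.Gamma (n + 3 / 2) / Real.Gamma (n + 1)) / √Real.pi := by
  have sqrt_two_sq : √2 ^ 2 = (2 : ℝ) := Real.sq_sqrt zero_le_two
  induction n with
  | zero =>
    rw [zero_add, Finset.range_one, Finset.sum_singleton, integral_exp_mul_hermiteFun_sq,
      Gamma_add_three_halves (Nat.cast_nonneg 0), Real.Gamma_nat_eq_factorial, Nat.cast_zero]
    field_simp
    linear_combination -sqrt_two_sq
  | succ n ih =>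
    rw [Finset.sum_range_succ, ih, integral_exp_mul_hermiteFun_sq,
      Gamma_add_three_halves (Nat.cast_nonneg (n + 1)), Real.Gamma_nat_eq_factorial,
      Real.Gamma_nat_eq_factorial, Nat.factorial_succ,
      show ((n + 1 : ℕ) : ℝ) + 1 / 2 = n + 3 / 2 by push_cast; ring]
    push_cast
    field_simp
    linear_combination (((n : ℝ) + 1) * 2 - (2 * n + 3)) * sqrt_two_sq

/-! ### The correction term -/

lemma integrable_exp_neg_sq : Integrable fun x : ℝ => Real.exp (-x ^ 2) := by
  simpa only [neg_mul, one_mul] using integrable_exp_neg_mul_sq (one_pos : (0 : ℝ) < 1)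

lemma integral_exp_neg_sq : ∫ x : ℝ, Real.exp (-x ^ 2) = √Real.pi := by
  simpa only [neg_mul, one_mul, div_one] using integral_gaussian 1

lemma epsilon_nonneg (n : ℕ) : 0 ≤ epsilon n := by
  have sum_le := sum_integral_mul_hermiteFun_sq_le integrable_exp_neg_sq
    (Eventually.of_forall fun x => (Real.exp_pos _).le) n
  rw [sum_integral_exp_mul_hermiteFun_sq, integral_exp_neg_sq, div_le_iff₀ (by positivity),
    mul_assoc, Real.mul_self_sqrt Real.pi_pos.le, div_mul_cancel₀ _ Real.pi_ne_zero] at sum_le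
  exact sub_nonneg.2 sum_le

lemma Gamma_add_half_div_Gamma_le_sqrt {x : ℝ} (hx : 0 < x) :
    Real.Gamma (x + 1 / 2) / Real.Gamma x ≤ √x := by
  have Gamma_pos := Real.Gamma_pos_of_pos hx
  have log_convexity := Real.Gamma_mul_add_mul_le_rpow_Gamma_mul_rpow_Gamma hx
    (add_pos hx one_pos) (one_half_pos (α := ℝ)) one_half_pos (add_halves 1)
  rw [div_le_iff₀ Gamma_pos]
  calc Real.Gamma (x + 1 / 2) = Real.Gamma (1 / 2 * x + 1 / 2 * (x + 1)) := by ring_nf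
    _ ≤ √(Real.Gamma x) * √(Real.Gamma (x + 1)) := by
        simpa only [Real.sqrt_eq_rpow] using log_convexity
    _ = √x * Real.Gamma x := by
        rw [Real.Gamma_add_one hx.ne', Real.sqrt_mul hx.le, mul_left_comm,
          Real.mul_self_sqrt Gamma_pos.le]

lemma div_sqrt_le_Gamma_add_half_div_Gamma {x : ℝ} (hx : 0 < x) :
    x / √(x + 1 / 2) ≤ Real.Gamma (x + 1 / 2) / Real.Gamma x := by
  have Gamma_pos := Real.Gamma_pos_of_pos hx
  have shifted_pos : 0 < x + 1 / 2 := by positivity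
  have upper_bound_shifted := Gamma_add_half_div_Gamma_le_sqrt shifted_pos
  rw [div_le_iff₀ (Real.Gamma_pos_of_pos shifted_pos), add_assoc, add_halves,
    Real.Gamma_add_one hx.ne'] at upper_bound_shifted
  rw [div_le_div_iff₀ (Real.sqrt_pos.2 shifted_pos) Gamma_pos]
  linarith

lemma omega_le_of_odd {n : ℕ} (h : Odd n) : omega n ≤ √(2 * (n + 3)) := by
  have half_pos : 0 < ((n : ℝ) + 1) / 2 := by positivity
  have one_le : (1 : ℝ) ≤ n := mod_cast h.pos
  have ratio_le := Gamma_add_half_div_Gamma_le_sqrt half_pos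
  rw [show ((n : ℝ) + 1) / 2 + 1 / 2 = n / 2 + 1 by ring] at ratio_le
  calc omega n = (2 * (n : ℝ) + 3) / (n + 1) * _ := omega_of_odd h
    _ ≤ (2 * (n : ℝ) + 3) / (n + 1) * √((n + 1) / 2) := by gcongr
    _ ≤ √(2 * (n + 3)) := by
      refine Real.le_sqrt_of_sq_le ?_
      rw [mul_pow, Real.sq_sqrt (by positivity), div_pow, div_mul_div_comm,
        div_le_iff₀ (by positivity)]
      nlinarith [pow_nonneg (n.cast_nonneg (α := ℝ)) 3]

lemma omega_le_of_not_odd {n : ℕ} (h : ¬Odd n) : omega n ≤ √(2 * (n + 3)) := by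
  have half_pos : 0 < ((n : ℝ) + 1) / 2 := by positivity
  have le_ratio := div_sqrt_le_Gamma_add_half_div_Gamma half_pos
  rw [show ((n : ℝ) + 1) / 2 + 1 / 2 = n / 2 + 1 by ring] at le_ratio
  calc omega n = (n + 1) * _ := omega_of_not_odd h
    _ = (n + 1) / (Real.Gamma (n / 2 + 1) / Real.Gamma ((n + 1) / 2)) := by
        rw [div_div_eq_mul_div, mul_div_assoc]
    _ ≤ (n + 1) / ((n + 1) / 2 / √(n / 2 + 1)) := by gcongr
    _ = √(2 ^ 2 * (n / 2 + 1)) := by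
        rw [Real.sqrt_mul (by positivity), Real.sqrt_sq zero_le_two]
        field_simp
    _ ≤ √(2 * (n + 3)) := Real.sqrt_le_sqrt (by linarith)

lemma omega_le (n : ℕ) : omega n ≤ √(2 * (n + 3)) :=
  (em (Odd n)).elim omega_le_of_odd omega_le_of_not_odd

lemma epsilon_le (n : ℕ) : epsilon n ≤ 2 * √2 * (1 / √(n + 3)) := by
  have le_ratio : ((n : ℝ) + 1) / √(n + 3) ≤ Real.Gamma (n + 3 / 2) / Real.Gamma (n + 1) := by
    have le_ratio := div_sqrt_le_Gamma_add_half_div_Gamma (x := n + 1) (by positivity)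
    rw [show (n : ℝ) + 1 + 1 / 2 = n + 3 / 2 by ring] at le_ratio
    refine le_trans ?_ le_ratio
    gcongr
    norm_num
  have sqrt_sq : √((n : ℝ) + 3) ^ 2 = n + 3 := Real.sq_sqrt (by positivity)
  calc epsilon n ≤ √(2 * (n + 3)) - √2 * ((n + 1) / √(n + 3)) :=
        sub_le_sub (omega_le n) (mul_le_mul_of_nonneg_left le_ratio (Real.sqrt_nonneg 2))
    _ = 2 * √2 * (1 / √(n + 3)) := by
        rw [Real.sqrt_mul zero_le_two]
        field_simp
        rw [sqrt_sq]
        ring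

lemma epsilon_isBigO : (fun n : ℕ => epsilon n) =O[atTop] fun n : ℕ => 1 / √(n : ℝ) := by
  refine IsBigO.of_bound (2 * √2) ?_
  filter_upwards [eventually_gt_atTop 0] with n n_pos
  rw [Real.norm_of_nonneg (epsilon_nonneg n), Real.norm_of_nonneg (by positivity)]
  refine (epsilon_le n).trans ?_
  gcongr
  linarith

/-! ### Completeness of the Hermite functions -/

lemma charFun_withDensity_ofReal {μ : Measure ℝ} {f : ℝ → ℝ} (hf : AEMeasurable f μ)
    (f_nonneg : 0 ≤ f) (t : ℝ) :
    charFun (μ.withDensity fun x => ENNReal.ofReal (f x)) t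
      = ∫ x, (f x : ℂ) * Complex.exp (t * x * Complex.I) ∂μ := by
  rw [charFun_apply_real, integral_withDensity_eq_integral_toReal_smul₀ hf.ennreal_ofReal
    (by simp)]
  refine integral_congr_ae (Eventually.of_forall fun x => ?_)
  simp [ENNReal.toReal_ofReal (f_nonneg x)]

lemma ae_eq_zero_of_integral_mul_cexp {μ : Measure ℝ} {g : ℝ → ℝ} (hg : Integrable g μ)
    (fourier : ∀ t : ℝ, ∫ x, (g x : ℂ) * Complex.exp (t * x * Complex.I) ∂μ = 0) :
    g =ᵐ[μ] 0 := by
  have integrable_mul_cexp {f : ℝ → ℝ} (hf : Integrable f μ) (t : ℝ) :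
      Integrable (fun x => (f x : ℂ) * Complex.exp (t * x * Complex.I)) μ := by
    refine hf.ofReal.mul_bdd (c := 1) (by fun_prop) (Eventually.of_forall fun x => ?_)
    rw [← Complex.ofReal_mul, Complex.norm_exp_ofReal_mul_I]
  have lintegral_ne_top {f : ℝ → ℝ} (hf : Integrable f μ) : ∫⁻ x, ENNReal.ofReal (f x) ∂μ ≠ ⊤ :=
    (hf.lintegral_lt_top).ne
  have pos_int : Integrable (fun x => max (g x) 0) μ := hg.pos_part
  have neg_int : Integrable (fun x => max (-g x) 0) μ := hg.neg_part
  have := isFiniteMeasure_withDensity (lintegral_ne_top pos_int)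
  have := isFiniteMeasure_withDensity (lintegral_ne_top neg_int)
  have measures_eq : μ.withDensity (fun x => ENNReal.ofReal (max (g x) 0))
      = μ.withDensity fun x => ENNReal.ofReal (max (-g x) 0) := by
    refine Measure.ext_of_charFun (funext fun t => ?_)
    rw [charFun_withDensity_ofReal pos_int.aemeasurable fun x => le_max_right _ _,
      charFun_withDensity_ofReal neg_int.aemeasurable fun x => le_max_right _ _, ← sub_eq_zero,
      ← integral_sub (integrable_mul_cexp pos_int t) (integrable_mul_cexp neg_int t), ← fourier t]
    simp only [← sub_mul, ← Complex.ofReal_sub, max_zero_sub_max_neg_zero_eq_self]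
  have densities_eq := (withDensity_eq_iff pos_int.aemeasurable.ennreal_ofReal
    neg_int.aemeasurable.ennreal_ofReal (lintegral_ne_top pos_int)).1 measures_eq
  filter_upwards [densities_eq] with x hx
  rw [ENNReal.ofReal_eq_ofReal_iff (le_max_right _ _) (le_max_right _ _)] at hx
  rw [Pi.zero_apply, ← max_zero_sub_max_neg_zero_eq_self (g x), hx, sub_self]

lemma hasSum_integral_mul_pow_div_factorial {μ : Measure ℝ} {g : ℝ → ℝ} {t : ℝ}
    (hg : AEStronglyMeasurable g μ) (exp_moment : Integrable (fun x => g x * Real.exp |t * x|) μ) :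
    HasSum (fun k : ℕ => ∫ x, (g x : ℂ) * ((t * x * Complex.I) ^ k / k.factorial) ∂μ)
      (∫ x, (g x : ℂ) * Complex.exp (t * x * Complex.I) ∂μ) := by
  refine hasSum_integral_of_dominated_convergence
    (fun k x => |g x| * (|t * x| ^ k / k.factorial)) (fun k => ?_) (fun k => ?_) ?_ ?_ ?_
  · refine (Complex.continuous_ofReal.comp_aestronglyMeasurable hg).mul
      (Continuous.aestronglyMeasurable ?_)
    fun_prop
  · refine Eventually.of_forall fun x => ?_
    simp [abs_mul]
  · refine Eventually.of_forall fun x => ?_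
    exact (Real.summable_pow_div_factorial _).mul_left _
  · refine exp_moment.norm.congr (Eventually.of_forall fun x => ?_)
    simp only [norm_mul, Real.norm_eq_abs, Real.abs_exp]
    rw [tsum_mul_left, Real.exp_eq_exp_ℝ, NormedSpace.exp_eq_tsum_div]
  · refine Eventually.of_forall fun x => ?_
    rw [Complex.exp_eq_exp_ℂ]
    exact (NormedSpace.expSeries_div_hasSum_exp ((t : ℂ) * x * Complex.I)).mul_left (g x : ℂ)

lemma ae_eq_zero_of_forall_integral_mul_pow_eq_zero {μ : Measure ℝ} {g : ℝ → ℝ}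
    (exp_moment : ∀ t : ℝ, Integrable (fun x => g x * Real.exp |t * x|) μ)
    (moment : ∀ k : ℕ, ∫ x, g x * x ^ k ∂μ = 0) : g =ᵐ[μ] 0 := by
  have hg : Integrable g μ := by
    simpa only [zero_mul, abs_zero, Real.exp_zero, mul_one] using exp_moment 0
  refine ae_eq_zero_of_integral_mul_cexp hg fun t => ?_
  refine (hasSum_integral_mul_pow_div_factorial hg.aestronglyMeasurable (exp_moment t)).unique ?_
  have term_eq_zero (k : ℕ) :
      ∫ x, (g x : ℂ) * ((t * x * Complex.I) ^ k / k.factorial) ∂μ = 0 := by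
    have integrand_eq (x : ℝ) : (g x : ℂ) * ((t * x * Complex.I) ^ k / k.factorial)
        = ((t * Complex.I) ^ k / k.factorial) * ((g x * x ^ k : ℝ) : ℂ) := by
      push_cast
      ring
    simp only [integrand_eq]
    rw [integral_const_mul, integral_complex_ofReal, moment, Complex.ofReal_zero, mul_zero]
  simpa only [term_eq_zero] using hasSum_zero

/-- The linear map sending a polynomial `p` to the class of `p(x) e^{-x²/2}` in `L²(ℝ)`. -/
def gaussPolyL2 : ℝ[X] →ₗ[ℝ] L2 where
  toFun p := (memLp_gaussPoly p).toLp
  map_add' p r := by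
    simpa only [map_add] using MemLp.toLp_add (memLp_gaussPoly p) (memLp_gaussPoly r)
  map_smul' c p := by
    simpa only [map_smul] using! MemLp.toLp_const_smul c (memLp_gaussPoly p)

lemma coeFn_gaussPolyL2 (p : ℝ[X]) : gaussPolyL2 p =ᵐ[volume] gaussPoly p :=
  (memLp_gaussPoly p).coeFn_toLp

lemma L2_inner_eq_integral (u v : L2) : inner ℝ u v = ∫ x, u x * v x := by
  rw [L2.inner_def]
  simp [mul_comm]

lemma inner_gaussPolyL2 (p : ℝ[X]) (u : L2) :
    inner ℝ (gaussPolyL2 p) u = ∫ x, u x * gaussPoly p x := by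
  rw [real_inner_comm, L2_inner_eq_integral]
  exact integral_congr_ae ((coeFn_gaussPolyL2 p).mono fun x hx => congrArg (u x * ·) hx)

lemma memLp_gauss_mul_exp (t : ℝ) :
    MemLp (fun x => gaussPoly 1 x * Real.exp |t * x|) 2 volume := by
  have continuous_mul : Continuous fun x : ℝ => gaussPoly 1 x * Real.exp |t * x| :=
    (continuous_gaussPoly 1).mul (by fun_prop)
  rw [memLp_two_iff_integrable_sq continuous_mul.aestronglyMeasurable]
  have gaussian_integrable := (integrable_exp_neg_mul_sq (one_half_pos (α := ℝ))).const_mul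
    (Real.exp (2 * t ^ 2))
  refine gaussian_integrable.mono' (continuous_mul.pow 2).aestronglyMeasurable
    (Eventually.of_forall fun x => ?_)
  -- `-x² + 2|tx| ≤ 2t² - x²/2`
  rw [Real.norm_of_nonneg (sq_nonneg _), gaussPoly_apply, eval_one, one_mul, ← Real.exp_add,
    ← Real.exp_add, ← Real.exp_nat_mul, Real.exp_le_exp, abs_mul]
  push_cast
  nlinarith [sq_nonneg (2 * |t| - |x|), sq_abs t, sq_abs x]

lemma eq_zero_of_inner_gaussPolyL2_eq_zero {u : L2} (hu : ∀ p, inner ℝ (gaussPolyL2 p) u = 0) :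
    u = 0 := by
  have gauss_mul_eq_zero := ae_eq_zero_of_forall_integral_mul_pow_eq_zero
    (μ := volume) (g := fun x => u x * gaussPoly 1 x)
    (fun t => ((Lp.memLp u).integrable_mul (q := 2) (memLp_gauss_mul_exp t)).congr
      (Eventually.of_forall fun x => (mul_assoc _ _ _).symm))
    fun k => by
      rw [← hu (X ^ k), inner_gaussPolyL2]
      simp only [gaussPoly_apply, eval_one, one_mul, eval_pow, eval_X]
      exact integral_congr_ae (Eventually.of_forall fun x => by ring)
  refine Lp.eq_zero_iff_ae_eq_zero.2 (gauss_mul_eq_zero.mono fun x hx => ?_)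
  simpa [gaussPoly_apply] using hx

/-- The `n`-th Hermite function as an element of `L²(ℝ)`. -/
def hermiteL2 (n : ℕ) : L2 := gaussPolyL2 (normHermitePoly n)

lemma coeFn_hermiteL2 (n : ℕ) : hermiteL2 n =ᵐ[volume] hermiteFun n := coeFn_gaussPolyL2 _

lemma orthonormal_hermiteL2 : Orthonormal ℝ hermiteL2 := by
  rw [orthonormal_iff_ite]
  intro i j
  rw [← integral_hermiteFun_mul_hermiteFun, L2_inner_eq_integral]
  exact integral_congr_ae ((coeFn_hermiteL2 i).mul (coeFn_hermiteL2 j))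

lemma span_hermiteL2_orthogonal : (Submodule.span ℝ (Set.range hermiteL2))ᗮ = ⊥ := by
  refine (Submodule.eq_bot_iff _).2 fun u hu => ?_
  have inner_eq_zero : (innerₗ L2 u).comp gaussPolyL2 = 0 := by
    refine LinearMap.ext_on_range span_range_hermitePoly fun n => ?_
    have inner_hermiteL2 : inner ℝ u (hermiteL2 n) = 0 :=
      Submodule.inner_left_of_mem_orthogonal (Submodule.subset_span (Set.mem_range_self n)) hu
    rw [hermiteL2, normHermitePoly, map_smul, real_inner_smul_right] at inner_hermiteL2
    exact (mul_eq_zero.1 inner_hermiteL2).resolve_left (hermiteConst_pos n).ne'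
  refine eq_zero_of_inner_gaussPolyL2_eq_zero fun p => ?_
  rw [real_inner_comm]
  exact LinearMap.congr_fun inner_eq_zero p

/-- The Hilbert basis of `L²(ℝ)` formed by the Hermite functions. -/
def hermiteBasis : HilbertBasis ℕ ℝ L2 :=
  HilbertBasis.mkOfOrthogonalEqBot orthonormal_hermiteL2 span_hermiteL2_orthogonal

lemma coe_hermiteBasis : ⇑hermiteBasis = hermiteL2 :=
  HilbertBasis.coe_mkOfOrthogonalEqBot orthonormal_hermiteL2 span_hermiteL2_orthogonal

/-! ### Quadratic forms given by an embedding of Hilbert spaces -/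

section FormEigenspace

variable {K H : Type*} [NormedAddCommGroup K] [InnerProductSpace ℝ K]
  [NormedAddCommGroup H] [InnerProductSpace ℝ H]

/-- The eigenspace at `Λ` of the operator on `H` associated with the inner product of `K`,
regarded as a quadratic form on `H` through the embedding `J`. -/
def formEigenspace (J : K →L[ℝ] H) (Λ : ℝ) : Submodule ℝ H where
  carrier := {x | ∃ k, J k = x ∧ ∀ k', inner ℝ k k' = Λ * inner ℝ x (J k')}
  zero_mem' := ⟨0, map_zero J, fun k' => by rw [inner_zero_left, inner_zero_left, mul_zero]⟩
  add_mem' := by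
    rintro x y ⟨k, hk, inner_k⟩ ⟨l, hl, inner_l⟩
    refine ⟨k + l, by rw [map_add, hk, hl], fun m => ?_⟩
    rw [inner_add_left, inner_add_left, inner_k, inner_l, mul_add]
  smul_mem' := by
    rintro c x ⟨k, hk, inner_k⟩
    refine ⟨c • k, by rw [map_smul, hk], fun m => ?_⟩
    rw [real_inner_smul_left, real_inner_smul_left, inner_k, mul_left_comm]

variable {J : K →L[ℝ] H}

lemma pos_of_mem_formEigenspace {Λ : ℝ} {x : H} (hx : x ∈ formEigenspace J Λ) (x_ne : x ≠ 0) :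
    0 < Λ := by
  obtain ⟨k, rfl, inner_k⟩ := hx
  have k_ne : k ≠ 0 := by
    rintro rfl
    exact x_ne (map_zero J)
  have norm_sq_pos : 0 < Λ * inner ℝ (J k) (J k) := inner_k k ▸ real_inner_self_pos.2 k_ne
  exact pos_of_mul_pos_left norm_sq_pos real_inner_self_nonneg

lemma orthogonalFamily_formEigenspace (J : K →L[ℝ] H) :
    OrthogonalFamily ℝ (fun Λ => formEigenspace J Λ) fun Λ => (formEigenspace J Λ).subtypeₗᵢ := by
  refine OrthogonalFamily.of_pairwise fun Λ M hne => Submodule.isOrtho_iff_inner_eq.2 ?_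
  rintro _ ⟨k, rfl, inner_k⟩ _ ⟨l, rfl, inner_l⟩
  have inner_symm := inner_l k
  rw [real_inner_comm, inner_k, real_inner_comm (J k), ← sub_eq_zero, ← sub_mul] at inner_symm
  exact (mul_eq_zero.1 inner_symm).resolve_left (sub_ne_zero.2 hne)

lemma sum_mul_inner_sq_le {ι : Type*} {w : ι → H} (hw : Orthonormal ℝ w) {Λ : ι → ℝ}
    (mem : ∀ i, w i ∈ formEigenspace J (Λ i)) (s : Finset ι) (p : K) :
    ∑ i ∈ s, Λ i * inner ℝ (w i) (J p) ^ 2 ≤ ‖p‖ ^ 2 := by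
  classical
  choose k hk inner_k using mem
  -- `q` is the orthogonal projection of `p` to the span of the `k i` in `K`
  set q : K := ∑ i ∈ s, inner ℝ (w i) (J p) • k i with hq
  have inner_q : inner ℝ q p = ∑ i ∈ s, Λ i * inner ℝ (w i) (J p) ^ 2 := by
    rw [hq, sum_inner]
    refine Finset.sum_congr rfl fun i _ => ?_
    rw [real_inner_smul_left, inner_k]
    ring
  have norm_q_sq : ‖q‖ ^ 2 = ∑ i ∈ s, Λ i * inner ℝ (w i) (J p) ^ 2 := by
    have J_q : J q = ∑ i ∈ s, inner ℝ (w i) (J p) • w i := by simp only [hq, map_sum, map_smul, hk]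
    rw [← real_inner_self_eq_norm_sq]
    nth_rewrite 1 [hq]
    rw [sum_inner]
    refine Finset.sum_congr rfl fun i hi => ?_
    rw [real_inner_smul_left, inner_k, J_q, hw.inner_right_sum _ hi]
    ring
  have norm_sub_sq := norm_sub_sq_real p q
  rw [real_inner_comm, inner_q, norm_q_sq] at norm_sub_sq
  linarith [sq_nonneg ‖p - q‖]

lemma norm_sub_sum_inner_smul_sq {ι : Type*} {w : ι → H} (hw : Orthonormal ℝ w) (s : Finset ι)
    (x : H) : ‖x - ∑ i ∈ s, inner ℝ (w i) x • w i‖ ^ 2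
      = ‖x‖ ^ 2 - ∑ i ∈ s, inner ℝ (w i) x ^ 2 := by
  have inner_sum : inner ℝ x (∑ i ∈ s, inner ℝ (w i) x • w i)
      = ∑ i ∈ s, inner ℝ (w i) x ^ 2 := by
    rw [_root_.inner_sum]
    refine Finset.sum_congr rfl fun i _ => ?_
    rw [real_inner_smul_right, real_inner_comm, sq]
  have norm_sum_sq : ‖∑ i ∈ s, inner ℝ (w i) x • w i‖ ^ 2 = ∑ i ∈ s, inner ℝ (w i) x ^ 2 := by
    rw [← real_inner_self_eq_norm_sq, hw.inner_sum]
    exact Finset.sum_congr rfl fun i _ => (sq _).symm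
  rw [norm_sub_sq_real, inner_sum, norm_sum_sq]
  ring

lemma hasSum_inner_sq {ι : Type*} (w : HilbertBasis ι ℝ H) (x : H) :
    HasSum (fun i => inner ℝ (w i) x ^ 2) (‖x‖ ^ 2) := by
  have parseval := w.hasSum_inner_mul_inner x x
  rw [real_inner_self_eq_norm_sq] at parseval
  exact parseval.congr_fun fun i => by rw [real_inner_comm, sq]

lemma mul_norm_sub_sum_sq_le {ι : Type*} {w : HilbertBasis ι ℝ H} {Λ : ι → ℝ}
    (mem : ∀ i, w i ∈ formEigenspace J (Λ i)) {s : Finset ι} {L : ℝ} (hL : ∀ i ∉ s, L ≤ Λ i)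
    (p : K) : L * ‖J p - ∑ i ∈ s, inner ℝ (w i) (J p) • w i‖ ^ 2 ≤ ‖p‖ ^ 2 := by
  classical
  rw [norm_sub_sum_inner_smul_sq w.orthonormal]
  refine le_of_tendsto (((hasSum_inner_sq w (J p)).sub_const _).const_mul L) ?_
  filter_upwards [eventually_ge_atTop s] with t hst
  rw [← Finset.sum_sdiff hst, add_sub_cancel_right, Finset.mul_sum]
  refine le_trans (Finset.sum_le_sum fun i hi => ?_)
    (sum_mul_inner_sq_le w.orthonormal mem (t \ s) p)
  exact mul_le_mul_of_nonneg_right (hL i (Finset.mem_sdiff.1 hi).2) (sq_nonneg _)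

lemma isCompactOperator_of_tendsto_cofinite [CompleteSpace H] {ι : Type*} {w : HilbertBasis ι ℝ H}
    {Λ : ι → ℝ} (mem : ∀ i, w i ∈ formEigenspace J (Λ i)) (hΛ : Tendsto Λ cofinite atTop) :
    IsCompactOperator J := by
  refine isClosed_setOfPred_isCompactOperator.closure_subset
    (Metric.mem_closure_iff.2 fun ε ε_pos => ?_)
  have finite_small : {i | ¬(2 / ε) ^ 2 ≤ Λ i}.Finite := hΛ.eventually_ge_atTop _
  set s := finite_small.toFinset
  set F : K →L[ℝ] H := ∑ i ∈ s, ((innerSL ℝ (w i)).smulRight (w i)).comp J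
  refine ⟨F, ?_, ?_⟩
  · refine Submodule.sum_mem (compactOperator (RingHom.id ℝ) K H) fun i _ => ?_
    have functional_compact : IsCompactOperator ((innerSL ℝ (w i)).comp J) :=
      isCompactOperator_of_locallyCompactSpace_dom _
    exact functional_compact.clm_comp ((ContinuousLinearMap.id ℝ ℝ).smulRight (w i))
  · rw [dist_eq_norm]
    refine (ContinuousLinearMap.opNorm_le_bound _ (half_pos ε_pos).le fun p => ?_).trans_lt
      (half_lt_self ε_pos)
    have norm_sq_le := mul_norm_sub_sum_sq_le mem (s := s) (L := (2 / ε) ^ 2)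
      (fun i hi => not_not.1 (mt finite_small.mem_toFinset.2 hi)) p
    rw [← mul_pow] at norm_sq_le
    have norm_le := le_of_sq_le_sq norm_sq_le (norm_nonneg _)
    rw [div_mul_eq_mul_div, div_le_iff₀ ε_pos] at norm_le
    have F_apply : F p = ∑ i ∈ s, inner ℝ (w i) (J p) • w i := by simp [F]
    rw [_root_.sub_apply, F_apply]
    linarith

lemma isCompactOperator_of_forall_exists_norm_le {K₀ : Type*} [NormedAddCommGroup K₀]
    [InnerProductSpace ℝ K₀] {J₀ : K₀ →L[ℝ] H} (hJ₀ : IsCompactOperator J₀)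
    (lift : ∀ k, ∃ k₀, J₀ k₀ = J k ∧ ‖k₀‖ ≤ ‖k‖) : IsCompactOperator J := by
  obtain ⟨C, C_compact, image_subset⟩ :=
    hJ₀.image_ball_subset_compact (f := (J₀ : K₀ →ₗ[ℝ] H)) 1
  refine (isCompactOperator_iff_image_ball_subset_compact (J : K →ₗ[ℝ] H) one_pos).2
    ⟨C, C_compact, ?_⟩
  rintro _ ⟨k, hk, rfl⟩
  obtain ⟨k₀, J_eq, norm_le⟩ := lift k
  exact image_subset ⟨k₀, mem_ball_zero_iff.2 (norm_le.trans_lt (mem_ball_zero_iff.1 hk)), J_eq⟩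

lemma finite_of_orthonormal_of_isCompact {ι : Type*} {w : ι → H} (hw : Orthonormal ℝ w)
    {C : Set H} (hC : IsCompact C) : {i | w i ∈ C}.Finite := by
  by_contra infinite
  set f := Set.Infinite.natEmbedding _ infinite
  obtain ⟨a, -, φ, φ_strictMono, tendsto_a⟩ := hC.tendsto_subseq fun n => (f n).2
  obtain ⟨N, dist_lt⟩ := Metric.cauchySeq_iff'.1 tendsto_a.cauchySeq 1 one_pos
  have dist_lt_one := dist_lt (N + 1) N.le_succ
  have ne : (f (φ (N + 1)) : ι) ≠ f (φ N) := fun eq =>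
    N.succ_ne_self (φ_strictMono.injective (f.injective (Subtype.ext eq)))
  have dist_sq := norm_sub_sq_real (w (f (φ (N + 1)))) (w (f (φ N)))
  rw [hw.2 ne, hw.1, hw.1, ← dist_eq_norm] at dist_sq
  simp only [Function.comp_apply] at dist_lt_one
  nlinarith [dist_nonneg (x := w (f (φ (N + 1)))) (y := w (f (φ N)))]

lemma finite_setOf_le_of_isCompactOperator (hJ : IsCompactOperator J) {ι : Type*} {w : ι → H}
    (hw : Orthonormal ℝ w) {Λ : ι → ℝ} (mem : ∀ i, w i ∈ formEigenspace J (Λ i)) (L : ℝ) :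
    {i | Λ i ≤ L}.Finite := by
  obtain ⟨C, C_compact, image_subset⟩ :=
    hJ.image_closedBall_subset_compact (f := (J : K →ₗ[ℝ] H)) √L
  refine (finite_of_orthonormal_of_isCompact hw C_compact).subset fun i hi => ?_
  obtain ⟨k, hk, inner_k⟩ := mem i
  have norm_k_sq := inner_k k
  rw [hk, real_inner_self_eq_norm_sq, real_inner_self_eq_norm_sq, hw.1, one_pow, mul_one]
    at norm_k_sq
  refine image_subset ⟨k, mem_closedBall_zero_iff.2 ?_, hk⟩
  exact Real.le_sqrt_of_sq_le (norm_k_sq ▸ hi)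

/-! ### Ky Fan's variational principle -/

/-- The bathtub principle: since `Λ` is nondecreasing, mass `n` with density at most `1` is placed
at the least cost on the first `n` sites. -/
lemma sum_range_le_of_hasSum {Λ a : ℕ → ℝ} {n : ℕ} {B : ℝ} (hΛ : Monotone Λ) (a_nonneg : 0 ≤ a)
    (a_le : ∀ j, a j ≤ 1) (ha : HasSum a n)
    (hB : ∀ M, ∑ j ∈ Finset.range M, Λ j * a j ≤ B) : ∑ j ∈ Finset.range n, Λ j ≤ B := by
  have tendsto_lower : Tendsto (fun M => ∑ j ∈ Finset.range n, Λ j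
      + Λ n * (∑ j ∈ Finset.range M, a j - n)) atTop (𝓝 (∑ j ∈ Finset.range n, Λ j)) := by
    simpa only [sub_self, mul_zero, add_zero] using
      ((ha.tendsto_sum_nat.sub_const (n : ℝ)).const_mul (Λ n)).const_add
        (∑ j ∈ Finset.range n, Λ j)
  refine le_of_tendsto tendsto_lower ?_
  filter_upwards [eventually_ge_atTop n] with M hM
  refine le_trans ?_ (hB M)
  have filled : ∑ j ∈ Finset.range n, (Λ j + Λ n * (a j - 1)) ≤ ∑ j ∈ Finset.range n, Λ j * a j :=
    Finset.sum_le_sum fun j hj => by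
      nlinarith [mul_nonneg (sub_nonneg.2 (hΛ (Finset.mem_range.1 hj).le))
        (sub_nonneg.2 (a_le j))]
  have overflow : ∑ j ∈ Finset.Ico n M, Λ n * a j ≤ ∑ j ∈ Finset.Ico n M, Λ j * a j :=
    Finset.sum_le_sum fun j hj =>
      mul_le_mul_of_nonneg_right (hΛ (Finset.mem_Ico.1 hj).1) (a_nonneg j)
  rw [Finset.sum_add_distrib, ← Finset.mul_sum, Finset.sum_sub_distrib, Finset.sum_const,
    Finset.card_range, nsmul_one] at filled
  rw [← Finset.mul_sum] at overflow
  rw [← Finset.sum_range_add_sum_Ico _ hM, ← Finset.sum_range_add_sum_Ico _ hM]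
  linarith

lemma sum_range_le_sum_norm_sq_of_hilbertBasis {w : HilbertBasis ℕ ℝ H} {Λ : ℕ → ℝ}
    (hΛ : Monotone Λ) (mem : ∀ j, w j ∈ formEigenspace J (Λ j)) {n : ℕ} {p : Fin n → K}
    (hp : Orthonormal ℝ fun i => J (p i)) :
    ∑ j ∈ Finset.range n, Λ j ≤ ∑ i, ‖p i‖ ^ 2 := by
  refine sum_range_le_of_hasSum (a := fun j => ∑ i, inner ℝ (w j) (J (p i)) ^ 2) hΛ
    (fun j => Finset.sum_nonneg fun i _ => sq_nonneg _) (fun j => ?_) ?_ fun M => ?_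
  · simpa [real_inner_comm, w.orthonormal.1 j] using
      hp.sum_inner_products_le (w j) (s := Finset.univ)
  · simpa [hp.1] using hasSum_sum (s := Finset.univ) fun i _ => hasSum_inner_sq w (J (p i))
  · simp only [Finset.mul_sum]
    rw [Finset.sum_comm]
    exact Finset.sum_le_sum fun i _ => sum_mul_inner_sq_le w.orthonormal mem _ _

/-! ### Compact embeddings -/

variable [CompleteSpace K] [CompleteSpace H]

open ContinuousLinearMap

lemma formEigenspace_eq_eigenspace {Λ : ℝ} (Λ_ne : Λ ≠ 0) :
    formEigenspace J Λ = Module.End.eigenspace ((J ∘L adjoint J : H →L[ℝ] H) : H →ₗ[ℝ] H) Λ⁻¹ := by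
  ext x
  rw [Module.End.mem_eigenspace_iff, ContinuousLinearMap.coe_coe, comp_apply]
  constructor
  · rintro ⟨k, rfl, inner_k⟩
    have k_eq : k = Λ • adjoint J (J k) := ext_inner_right ℝ fun v => by
      rw [inner_k, real_inner_smul_left, adjoint_inner_left]
    have adjoint_eq : adjoint J (J k) = Λ⁻¹ • k := (inv_smul_eq_iff₀ Λ_ne).2 k_eq |>.symm
    rw [adjoint_eq, map_smul]
  · intro eigen
    refine ⟨Λ • adjoint J x, ?_, fun k => ?_⟩
    · rw [map_smul, eigen, smul_inv_smul₀ Λ_ne]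
    · rw [real_inner_smul_left, adjoint_inner_left]

lemma isCompactOperator_comp_adjoint (hJ : IsCompactOperator J) :
    IsCompactOperator (J ∘L adjoint J : H →L[ℝ] H) :=
  hJ.comp_clm _

lemma finiteDimensional_formEigenspace (hJ : IsCompactOperator J) (Λ : ℝ) :
    FiniteDimensional ℝ (formEigenspace J Λ) := by
  rcases eq_or_ne Λ 0 with rfl | Λ_ne
  · have eq_bot : formEigenspace J 0 = ⊥ := (Submodule.eq_bot_iff _).2 fun x hx =>
      of_not_not fun x_ne => lt_irrefl _ (pos_of_mem_formEigenspace hx x_ne)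
    rw [eq_bot]
    infer_instance
  · rw [formEigenspace_eq_eigenspace Λ_ne]
    exact finite_dimensional_eigenspace (isCompactOperator_comp_adjoint hJ) _ (inv_ne_zero Λ_ne)

lemma iSup_formEigenspace_orthogonal (hJ : IsCompactOperator J) (J_dense : DenseRange J) :
    (⨆ Λ, formEigenspace J Λ)ᗮ = ⊥ := by
  have symmetric : ((J ∘L adjoint J : H →L[ℝ] H) : H →ₗ[ℝ] H).IsSymmetric := fun x y => by
    simp only [ContinuousLinearMap.coe_coe, comp_apply]
    rw [← adjoint_inner_right, ← adjoint_inner_left J]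
  rw [eq_bot_iff,
    ← orthogonalComplement_iSup_eigenspaces_eq_bot (isCompactOperator_comp_adjoint hJ) symmetric]
  refine Submodule.orthogonal_le (iSup_le fun μ x hx => ?_)
  have eigen : J (adjoint J x) = μ • x := Module.End.mem_eigenspace_iff.1 hx
  rcases eq_or_ne μ 0 with rfl | μ_ne
  · have adjoint_eq_zero : adjoint J x = 0 := by
      rw [← inner_self_eq_zero (𝕜 := ℝ), adjoint_inner_left, eigen, zero_smul, inner_zero_right]
    have x_eq_zero : x = 0 := J_dense.eq_zero_of_inner_left ℝ fun k => by
      rw [← adjoint_inner_left, adjoint_eq_zero, inner_zero_left]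
    exact x_eq_zero ▸ Submodule.zero_mem _
  · refine Submodule.mem_iSup_of_mem μ⁻¹ ?_
    rwa [formEigenspace_eq_eigenspace (inv_ne_zero μ_ne), inv_inv]

end FormEigenspace

/-! ### Enumeration of eigenvalues with multiplicity -/

lemma nonempty_orderIso_nat {ι : Type*} [LinearOrder ι] [Infinite ι]
    (finite_Iic : ∀ i : ι, (Set.Iic i).Finite) : Nonempty (ι ≃o ℕ) := by
  let : LocallyFiniteOrder ι := LocallyFiniteOrder.ofFiniteIcc fun a b =>
    (finite_Iic b).subset Set.Icc_subset_Iic_self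
  have : NoMaxOrder ι := ⟨fun a => by
    by_contra! le_a
    exact Set.infinite_univ ((finite_Iic a).subset fun x _ => le_a x)⟩
  obtain ⟨i⟩ : Nonempty ι := inferInstance
  obtain ⟨m, hm, m_le⟩ := Set.exists_min_image (Set.Iic i) id (finite_Iic i) ⟨i, le_rfl⟩
  let : OrderBot ι :=
    { bot := m
      bot_le := fun x => (le_total x i).elim (m_le x) hm.trans }
  let : SuccOrder ι := LinearLocallyFiniteOrder.succOrder ι
  let : PredOrder ι := LinearLocallyFiniteOrder.predOrder ι
  exact ⟨orderIsoNatOfLinearSuccPredArch⟩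

lemma exists_equiv_monotone {ι : Type*} [Infinite ι] {f : ι → ℝ}
    (finite_le : ∀ L, {i | f i ≤ L}.Finite) : ∃ e : ℕ ≃ ι, Monotone (f ∘ e) := by
  -- order `ι` by the value of `f`, breaking ties by an arbitrary linear order
  let g : ι → ℝ ×ₗ Cardinal := fun i => toLex (f i, embeddingToCardinal i)
  have g_injective : Function.Injective g := fun i j h =>
    embeddingToCardinal.injective (congrArg (fun p => (ofLex p).2) h)
  let : LinearOrder ι := LinearOrder.lift' g g_injective
  have f_monotone : Monotone f := fun i j hij => by
    rcases Prod.Lex.le_iff.1 (show g i ≤ g j from hij) with lt | eq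
    exacts [lt.le, eq.1.le]
  obtain ⟨e⟩ := nonempty_orderIso_nat fun i : ι => (finite_le (f i)).subset fun j => @f_monotone j i
  exact ⟨e.symm.toEquiv, f_monotone.comp e.symm.monotone⟩

/-- `lam` lists the real numbers `μ`, each repeated `m μ` times, in nondecreasing order. -/
structure IsEnumeration (m : ℝ → ℕ) (lam : ℕ → ℝ) : Prop where
  monotone : Monotone lam
  tendsto : Tendsto lam atTop atTop
  multiplicity : ∀ μ, m μ = {k | lam k = μ}.ncard

namespace IsEnumeration

variable {m : ℝ → ℕ} {lam : ℕ → ℝ}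

lemma add_const_iff {c : ℝ} :
    IsEnumeration m (fun k => lam k + c) ↔ IsEnumeration (fun μ => m (μ + c)) lam := by
  constructor
  · rintro ⟨monotone, tendsto, multiplicity⟩
    refine ⟨fun i j hij => le_of_add_le_add_right (monotone hij), ?_, fun μ => ?_⟩
    · simpa only [add_neg_cancel_right] using tendsto_atTop_add_const_right _ (-c) tendsto
    · simp only [multiplicity, add_left_inj]
  · rintro ⟨monotone, tendsto, multiplicity⟩
    refine ⟨monotone.add_const c, tendsto_atTop_add_const_right _ c tendsto, fun μ => ?_⟩
    rw [← sub_add_cancel μ c, multiplicity]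
    simp only [add_left_inj]

lemma exists_equiv (h : IsEnumeration m lam) :
    ∃ e : ℕ ≃ Σ μ, Fin (m μ), ∀ k, (e k).1 = lam k := by
  have finite_fiber : ∀ μ, Finite {k // lam k = μ} := fun μ => by
    have finite_le : {k | ¬μ < lam k}.Finite := by
      have := h.tendsto.eventually_gt_atTop μ
      rwa [← Nat.cofinite_eq_atTop] at this
    exact (finite_le.subset fun k (hk : lam k = μ) => hk.not_gt).to_subtype
  exact ⟨(Equiv.sigmaFiberEquiv lam).symm.trans
    (Equiv.sigmaCongrRight fun μ => Finite.equivFinOfCardEq (h.multiplicity μ).symm), fun _ => rfl⟩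

end IsEnumeration

lemma exists_isEnumeration {m : ℝ → ℕ} [Infinite (Σ μ, Fin (m μ))]
    (finite_le : ∀ L, {i : Σ μ, Fin (m μ) | i.1 ≤ L}.Finite) : ∃ lam, IsEnumeration m lam := by
  obtain ⟨e, monotone⟩ := exists_equiv_monotone finite_le
  refine ⟨fun k => (e k).1, monotone, tendsto_atTop.2 fun L => ?_, fun μ => ?_⟩
  · rw [← Nat.cofinite_eq_atTop]
    filter_upwards [((finite_le L).preimage e.injective.injOn).compl_mem_cofinite] with k hk
    exact (not_le.1 (show ¬(e k).1 ≤ L from hk)).le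
  · rw [← Nat.card_fin (m μ), ← Nat.card_coe_set_eq]
    exact Nat.card_congr ((e.subtypeEquiv fun _ => Iff.rfl).trans (Equiv.sigmaSubtype μ)).symm

section Enumeration

variable {K H : Type*} [NormedAddCommGroup K] [InnerProductSpace ℝ K] [CompleteSpace K]
  [NormedAddCommGroup H] [InnerProductSpace ℝ H] [CompleteSpace H] {J : K →L[ℝ] H}

lemma exists_hilbertBasis_formEigenspace (hJ : IsCompactOperator J) (J_dense : DenseRange J) :
    ∃ w : HilbertBasis (Σ Λ, Fin (Module.finrank ℝ (formEigenspace J Λ))) ℝ H,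
      ∀ i, w i ∈ formEigenspace J i.1 := by
  have := finiteDimensional_formEigenspace hJ
  set b := fun Λ => stdOrthonormalBasis ℝ (formEigenspace J Λ)
  have orthonormal : Orthonormal ℝ
      fun i : Σ Λ, Fin (Module.finrank ℝ (formEigenspace J Λ)) => (b i.1 i.2 : H) :=
    (orthogonalFamily_formEigenspace J).orthonormal_sigma_orthonormal fun Λ => (b Λ).orthonormal
  refine ⟨HilbertBasis.mkOfOrthogonalEqBot orthonormal ?_, fun i => ?_⟩
  · rw [eq_bot_iff, ← iSup_formEigenspace_orthogonal hJ J_dense]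
    refine Submodule.orthogonal_le (iSup_le fun Λ x hx => ?_)
    change (formEigenspace J Λ).subtype ⟨x, hx⟩ ∈ _
    rw [← (b Λ).sum_repr ⟨x, hx⟩, map_sum]
    exact Submodule.sum_mem _ fun i _ =>
      Submodule.smul_mem _ _ (Submodule.subset_span ⟨⟨Λ, i⟩, rfl⟩)
  · rw [HilbertBasis.coe_mkOfOrthogonalEqBot]
    exact Subtype.coe_prop _

lemma exists_isEnumeration_formEigenspace (hJ : IsCompactOperator J) (J_dense : DenseRange J)
    (infinite : ¬FiniteDimensional ℝ H) :
    ∃ lam, IsEnumeration (fun Λ => Module.finrank ℝ (formEigenspace J Λ)) lam := by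
  obtain ⟨w, mem⟩ := exists_hilbertBasis_formEigenspace hJ J_dense
  have : Infinite (Σ Λ, Fin (Module.finrank ℝ (formEigenspace J Λ))) := by
    by_contra finite
    rw [not_infinite_iff_finite] at finite
    have := Fintype.ofFinite (Σ Λ, Fin (Module.finrank ℝ (formEigenspace J Λ)))
    exact infinite w.toOrthonormalBasis.toBasis.finiteDimensional_of_finite
  exact exists_isEnumeration (finite_setOf_le_of_isCompactOperator hJ w.orthonormal mem)

lemma sum_range_le_sum_norm_sq (hJ : IsCompactOperator J) (J_dense : DenseRange J) {lam : ℕ → ℝ}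
    (hlam : IsEnumeration (fun Λ => Module.finrank ℝ (formEigenspace J Λ)) lam) {n : ℕ}
    {p : Fin n → K} (hp : Orthonormal ℝ fun i => J (p i)) :
    ∑ j ∈ Finset.range n, lam j ≤ ∑ i, ‖p i‖ ^ 2 := by
  obtain ⟨w, mem⟩ := exists_hilbertBasis_formEigenspace hJ J_dense
  obtain ⟨e, fst_e⟩ := hlam.exists_equiv
  have dense_span : ⊤ ≤ (Submodule.span ℝ (Set.range (w ∘ e))).topologicalClosure := by
    rw [e.surjective.range_comp, w.dense_span]
  refine sum_range_le_sum_norm_sq_of_hilbertBasis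
    (w := HilbertBasis.mk (w.orthonormal.comp e e.injective) dense_span) hlam.monotone
    (fun j => ?_) hp
  rw [HilbertBasis.coe_mk, ← fst_e]
  exact mem (e j)

end Enumeration

/-! ### Weak derivatives -/

/-- Smooth cutoff functions with compact support, equal to `1` on `[-(n + 1), n + 1]`. -/
def cutoff (n : ℕ) (x : ℝ) : ℝ :=
  (⟨1, 2, one_pos, one_lt_two⟩ : ContDiffBump (0 : ℝ)) (((n : ℝ) + 1)⁻¹ * x)

lemma contDiff_cutoff (n : ℕ) : ContDiff ℝ ∞ (cutoff n) :=
  (ContDiffBump.contDiff _).comp (contDiff_const.mul contDiff_id)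

lemma hasCompactSupport_cutoff (n : ℕ) : HasCompactSupport (cutoff n) :=
  (ContDiffBump.hasCompactSupport _).comp_homeomorph
    (Homeomorph.mulLeft₀ ((n : ℝ) + 1)⁻¹ (by positivity))

lemma norm_cutoff_le_one (n : ℕ) (x : ℝ) : ‖cutoff n x‖ ≤ 1 :=
  (Real.norm_of_nonneg (ContDiffBump.nonneg _)).trans_le (ContDiffBump.le_one _)

lemma tendsto_cutoff (x : ℝ) : Tendsto (fun n => cutoff n x) atTop (𝓝 1) := by
  refine tendsto_const_nhds.congr' ?_
  filter_upwards [eventually_ge_atTop ⌈|x|⌉₊] with n hn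
  refine (ContDiffBump.one_of_mem_closedBall _ ?_).symm
  rw [mem_closedBall_zero_iff, norm_mul, norm_inv, Real.norm_of_nonneg (by positivity),
    inv_mul_le_one₀ (by positivity)]
  exact (Nat.ceil_le.1 hn).trans (le_add_of_nonneg_right zero_le_one)

lemma exists_norm_deriv_cutoff_le : ∃ C, ∀ n x, ‖deriv (cutoff n) x‖ ≤ C / ((n : ℝ) + 1) := by
  set χ : ContDiffBump (0 : ℝ) := ⟨1, 2, one_pos, one_lt_two⟩
  obtain ⟨C, hC⟩ := (χ.contDiff.continuous_deriv (n := 1) le_rfl).bounded_above_of_compact_support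
    χ.hasCompactSupport.deriv
  refine ⟨C, fun n x => ?_⟩
  have deriv_eq : deriv (cutoff n) x = ((n : ℝ) + 1)⁻¹ • deriv χ (((n : ℝ) + 1)⁻¹ * x) :=
    deriv_comp_mul_left _ _ _
  rw [deriv_eq, norm_smul, norm_inv, Real.norm_of_nonneg (by positivity), div_eq_inv_mul]
  exact mul_le_mul_of_nonneg_left (hC _) (by positivity)

lemma tendsto_integral_mul_of_norm_le {f : ℝ → ℝ} (hf : Integrable f) {χ : ℕ → ℝ → ℝ}
    (χ_continuous : ∀ n, Continuous (χ n)) {C a : ℝ} (norm_χ_le : ∀ n x, ‖χ n x‖ ≤ C)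
    (hχ : ∀ x, Tendsto (fun n => χ n x) atTop (𝓝 a)) :
    Tendsto (fun n => ∫ x, χ n x * f x) atTop (𝓝 (a * ∫ x, f x)) := by
  rw [← integral_const_mul]
  refine tendsto_integral_of_dominated_convergence (fun x => C * ‖f x‖)
    (fun n => (χ_continuous n).aestronglyMeasurable.mul hf.aestronglyMeasurable)
    (hf.norm.const_mul C) (fun n => Eventually.of_forall fun x => ?_)
    (Eventually.of_forall fun x => (hχ x).mul_const (f x))
  rw [norm_mul]
  exact mul_le_mul_of_nonneg_right (norm_χ_le n x) (norm_nonneg _)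

lemma tendsto_deriv_cutoff (x : ℝ) : Tendsto (fun n => deriv (cutoff n) x) atTop (𝓝 0) := by
  obtain ⟨C, hC⟩ := exists_norm_deriv_cutoff_le
  refine squeeze_zero_norm (hC · x) ?_
  simpa only [mul_one_div, mul_zero] using
    (tendsto_one_div_add_atTop_nhds_zero_nat (𝕜 := ℝ)).const_mul C

lemma exists_norm_deriv_cutoff_le_const : ∃ C, ∀ n x, ‖deriv (cutoff n) x‖ ≤ C := by
  obtain ⟨C, hC⟩ := exists_norm_deriv_cutoff_le
  have C_nonneg : 0 ≤ C := by simpa using (norm_nonneg _).trans (hC 0 0)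
  exact ⟨C, fun n x => (hC n x).trans (div_le_self C_nonneg (by simp))⟩

lemma IsWeakDeriv.integral_mul_deriv {u g : L2} (h : IsWeakDeriv u g) {φ : ℝ → ℝ}
    (hφ : ContDiff ℝ ∞ φ) (φ_memLp : MemLp φ 2 volume) (deriv_memLp : MemLp (deriv φ) 2 volume) :
    ∫ x, u x * deriv φ x = -∫ x, g x * φ x := by
  obtain ⟨C, hC⟩ := exists_norm_deriv_cutoff_le_const
  have cutoff_continuous (n : ℕ) := (contDiff_cutoff n).continuous
  have deriv_continuous (n : ℕ) : Continuous (deriv (cutoff n)) :=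
    (contDiff_cutoff n).continuous_deriv (by simp)
  have uφ : Integrable fun x => u x * φ x := (Lp.memLp u).integrable_mul φ_memLp
  have udφ : Integrable fun x => u x * deriv φ x := (Lp.memLp u).integrable_mul deriv_memLp
  have gφ : Integrable fun x => g x * φ x := (Lp.memLp g).integrable_mul φ_memLp
  have cutoff_identity (n : ℕ) : (∫ x, deriv (cutoff n) x * (u x * φ x))
      + ∫ x, cutoff n x * (u x * deriv φ x) = -∫ x, cutoff n x * (g x * φ x) := by
    rw [← integral_add
      (uφ.bdd_mul (deriv_continuous n).aestronglyMeasurable (Eventually.of_forall (hC n)))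
      (udφ.bdd_mul (cutoff_continuous n).aestronglyMeasurable
        (Eventually.of_forall (norm_cutoff_le_one n)))]
    have weak := h (cutoff n * φ) ((contDiff_cutoff n).mul hφ)
      (hasCompactSupport_cutoff n).mul_right
    have deriv_mul (x : ℝ) : deriv (cutoff n * φ) x
        = deriv (cutoff n) x * φ x + cutoff n x * deriv φ x :=
      _root_.deriv_mul ((contDiff_cutoff n).differentiable (by simp) x)
        (hφ.differentiable (by simp) x)
    simp only [deriv_mul, Pi.mul_apply] at weak
    convert weak using 4 <;> ring
  have limits := (tendsto_integral_mul_of_norm_le uφ deriv_continuous hC tendsto_deriv_cutoff).add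
    (tendsto_integral_mul_of_norm_le udφ cutoff_continuous norm_cutoff_le_one tendsto_cutoff)
  simp only [cutoff_identity, zero_mul, zero_add, one_mul] at limits
  refine tendsto_nhds_unique limits ?_
  simpa only [one_mul] using
    (tendsto_integral_mul_of_norm_le gφ cutoff_continuous norm_cutoff_le_one tendsto_cutoff).neg

lemma deriv_gaussPoly (p : ℝ[X]) : deriv (gaussPoly p) = gaussPoly (derivative p - X * p) :=
  funext fun x => (hasDerivAt_gaussPoly p x).deriv

lemma IsWeakDeriv.inner_gaussPolyL2 {u g : L2} (h : IsWeakDeriv u g) (p : ℝ[X]) :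
    inner ℝ (gaussPolyL2 (derivative p - X * p)) u = -inner ℝ (gaussPolyL2 p) g := by
  have by_parts := h.integral_mul_deriv (contDiff_gaussPoly p) (memLp_gaussPoly p)
    (deriv_gaussPoly p ▸ memLp_gaussPoly _)
  rwa [deriv_gaussPoly, ← PerturbedOscillator.inner_gaussPolyL2,
    ← PerturbedOscillator.inner_gaussPolyL2] at by_parts

lemma isWeakDeriv_gaussPolyL2 (p : ℝ[X]) :
    IsWeakDeriv (gaussPolyL2 p) (gaussPolyL2 (derivative p - X * p)) := fun φ hφ hc => by
  have by_parts := integral_mul_deriv_eq_deriv_mul_of_integrable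
    (fun x _ => hasDerivAt_gaussPoly p x)
    (fun x _ => (hφ.differentiable (by simp) x).hasDerivAt)
    (((continuous_gaussPoly p).mul (hφ.continuous_deriv (by simp))).integrable_of_hasCompactSupport
      hc.deriv.mul_left)
    (((continuous_gaussPoly _).mul hφ.continuous).integrable_of_hasCompactSupport hc.mul_left)
    (((continuous_gaussPoly p).mul hφ.continuous).integrable_of_hasCompactSupport hc.mul_left)
  refine (integral_congr_ae ((coeFn_gaussPolyL2 _).mul EventuallyEq.rfl)).trans (by_parts.trans ?_)
  exact congrArg _ (integral_congr_ae ((coeFn_gaussPolyL2 _).symm.mul EventuallyEq.rfl))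

lemma isClosed_setOf_isWeakDeriv : IsClosed {p : L2 × L2 | IsWeakDeriv p.1 p.2} := by
  have continuous_integral {f : ℝ → ℝ} (hf : MemLp f 2 volume) :
      Continuous fun u : L2 => ∫ x, u x * f x := by
    have integral_eq (u : L2) : ∫ x, u x * f x = inner ℝ u hf.toLp := by
      rw [L2_inner_eq_integral]
      exact integral_congr_ae (EventuallyEq.rfl.mul hf.coeFn_toLp.symm)
    simp only [integral_eq]
    fun_prop
  simp only [IsWeakDeriv, Set.ofPred_forall]
  refine isClosed_iInter fun φ => isClosed_iInter fun hφ => isClosed_iInter fun hc => ?_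
  have deriv_memLp : MemLp (deriv φ) 2 volume :=
    (hφ.continuous_deriv (by simp)).memLp_of_hasCompactSupport hc.deriv
  have φ_memLp : MemLp φ 2 volume := hφ.continuous.memLp_of_hasCompactSupport hc
  exact isClosed_eq ((continuous_integral deriv_memLp).comp continuous_fst)
    ((continuous_integral φ_memLp).comp continuous_snd).neg

lemma isClosed_setOf_ae_eq_mul (s : ℝ → ℝ) :
    IsClosed {p : L2 × L2 | p.2 =ᵐ[volume] fun x => s x * p.1 x} := by
  refine IsSeqClosed.isClosed fun p q hp hq => ?_
  have tendsto_fst : Tendsto (fun n => (p n).1) atTop (𝓝 q.1) := (continuous_fst.tendsto q).comp hq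
  have tendsto_snd : Tendsto (fun n => (p n).2) atTop (𝓝 q.2) := (continuous_snd.tendsto q).comp hq
  obtain ⟨a, a_strictMono, tendsto_fst_ae⟩ :=
    (tendstoInMeasure_of_tendsto_Lp tendsto_fst).exists_seq_tendsto_ae
  obtain ⟨b, b_strictMono, tendsto_snd_ae⟩ := (tendstoInMeasure_of_tendsto_Lp
    (tendsto_snd.comp a_strictMono.tendsto_atTop)).exists_seq_tendsto_ae
  change q.2 =ᵐ[volume] fun x => s x * q.1 x
  filter_upwards [tendsto_fst_ae, tendsto_snd_ae, ae_all_iff.2 hp] with x fst_x snd_x eq_x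
  refine tendsto_nhds_unique snd_x ?_
  refine ((fst_x.comp b_strictMono.tendsto_atTop).const_mul (s x)).congr fun n => ?_
  simp only [Function.comp_apply, eq_x]

/-! ### The form space -/

/-- Triples of square integrable functions. -/
abbrev L2Triple : Type := WithLp 2 (L2 × WithLp 2 (L2 × L2))

/-- The Hilbert space of triples `(u, u', s u)` in `L²(ℝ)`. If `s² = V + c`, this is the form domain
of `-d²/dx² + V` with the inner product `∫ u' v' + ∫ V u v + (c + 1) ∫ u v`. -/
def formSubmodule (s : ℝ → ℝ) : Submodule ℝ L2Triple where
  carrier := {k | IsWeakDeriv k.fst k.snd.fst ∧ k.snd.snd =ᵐ[volume] fun x => s x * k.fst x}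
  zero_mem' := by
    refine ⟨IsWeakDeriv.zero, ?_⟩
    filter_upwards [Lp.coeFn_zero ℝ 2 (volume : Measure ℝ)] with x _
    simp
  add_mem' := by
    rintro k l ⟨k_deriv, k_mul⟩ ⟨l_deriv, l_mul⟩
    refine ⟨k_deriv.add l_deriv, ?_⟩
    filter_upwards [k_mul, l_mul, Lp.coeFn_add k.snd.snd l.snd.snd, Lp.coeFn_add k.fst l.fst]
      with x k_x l_x snd_add fst_add
    simp only [WithLp.add_snd, WithLp.add_fst, snd_add, fst_add, Pi.add_apply, k_x, l_x, mul_add]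
  smul_mem' := by
    rintro a k ⟨k_deriv, k_mul⟩
    refine ⟨k_deriv.smul a, ?_⟩
    filter_upwards [k_mul, Lp.coeFn_smul a k.snd.snd, Lp.coeFn_smul a k.fst]
      with x k_x snd_smul fst_smul
    simp only [WithLp.smul_snd, WithLp.smul_fst, snd_smul, fst_smul, Pi.smul_apply, k_x,
      smul_eq_mul, mul_left_comm]

/-- The form space as a type of its own, so that its only topology is the one given by the norm. -/
def FormSpace (s : ℝ → ℝ) : Type := formSubmodule s

namespace FormSpace

instance (s : ℝ → ℝ) : NormedAddCommGroup (FormSpace s) :=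
  inferInstanceAs (NormedAddCommGroup (formSubmodule s))

instance (s : ℝ → ℝ) : InnerProductSpace ℝ (FormSpace s) :=
  inferInstanceAs (InnerProductSpace ℝ (formSubmodule s))

instance (s : ℝ → ℝ) : CompleteSpace (FormSpace s) := by
  have fst_continuous : Continuous fun k : L2Triple => (k.fst, k.snd.fst) := by fun_prop
  have snd_continuous : Continuous fun k : L2Triple => (k.fst, k.snd.snd) := by fun_prop
  have isClosed : IsClosed (formSubmodule s : Set L2Triple) :=
    (isClosed_setOf_isWeakDeriv.preimage fst_continuous).inter
      ((isClosed_setOf_ae_eq_mul s).preimage snd_continuous)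
  exact isClosed.completeSpace_coe

/-- The element `(u, u', s u)` of the form space. -/
def mk {s : ℝ → ℝ} (u g w : L2) (isWeakDeriv : IsWeakDeriv u g)
    (ae_eq_mul : w =ᵐ[volume] fun x => s x * u x) : FormSpace s :=
  ⟨.toLp 2 (u, .toLp 2 (g, w)), isWeakDeriv, ae_eq_mul⟩

/-- The embedding `(u, u', s u) ↦ u` of the form space into `L²(ℝ)`. -/
def embedding (s : ℝ → ℝ) : FormSpace s →L[ℝ] L2 :=
  (WithLp.fstL 2 ℝ L2 (WithLp 2 (L2 × L2))).comp (formSubmodule s).subtypeL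

variable {s : ℝ → ℝ}

/-- The weak derivative `u'` of `u`. -/
def weakDeriv (k : FormSpace s) : L2 := k.1.snd.fst

/-- The product `s u`. -/
def weighted (k : FormSpace s) : L2 := k.1.snd.snd

lemma isWeakDeriv (k : FormSpace s) : IsWeakDeriv (embedding s k) k.weakDeriv := k.2.1

lemma weighted_ae_eq (k : FormSpace s) : k.weighted =ᵐ[volume] fun x => s x * embedding s k x :=
  k.2.2

lemma inner_eq (k l : FormSpace s) : inner ℝ k l
    = inner ℝ (embedding s k) (embedding s l)
      + (inner ℝ k.weakDeriv l.weakDeriv + inner ℝ k.weighted l.weighted) := by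
  change inner ℝ k.1 l.1 = _
  rw [WithLp.prod_inner_apply, WithLp.prod_inner_apply]
  rfl

lemma norm_sq_eq (k : FormSpace s) :
    ‖k‖ ^ 2 = ‖embedding s k‖ ^ 2 + (‖k.weakDeriv‖ ^ 2 + ‖k.weighted‖ ^ 2) := by
  simp only [← real_inner_self_eq_norm_sq, inner_eq]

section mk

variable {u g w : L2} (hg : IsWeakDeriv u g) (hw : w =ᵐ[volume] fun x => s x * u x)

@[simp] lemma embedding_mk : embedding s (mk u g w hg hw) = u := rfl

@[simp] lemma weakDeriv_mk : (mk u g w hg hw).weakDeriv = g := rfl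

@[simp] lemma weighted_mk : (mk u g w hg hw).weighted = w := rfl

end mk

end FormSpace

open FormSpace

section Potential

variable {V s : ℝ → ℝ} {c : ℝ}

lemma embedding_mem_formDomain (s_sq : ∀ᵐ x, s x ^ 2 = V x + c) (k : FormSpace s) :
    embedding s k ∈ formDomain V := by
  refine ⟨⟨_, k.isWeakDeriv⟩, ?_⟩
  refine ((Lp.memLp k.weighted).integrable_sq.sub
    ((Lp.memLp (embedding s k)).integrable_sq.const_mul c)).congr ?_
  filter_upwards [k.weighted_ae_eq, s_sq] with x weighted_x s_sq_x
  simp only [Pi.sub_apply, weighted_x, mul_pow, s_sq_x]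
  ring

lemma exists_formSpace_of_mem_formDomain (s_meas : AEStronglyMeasurable s)
    (s_sq : ∀ᵐ x, s x ^ 2 = V x + c) {u g : L2} (hu : u ∈ formDomain V) (hg : IsWeakDeriv u g) :
    ∃ k : FormSpace s, embedding s k = u ∧ k.weakDeriv = g := by
  have memLp_mul : MemLp (fun x => s x * u x) 2 := by
    refine (memLp_two_iff_integrable_sq (s_meas.mul (Lp.aestronglyMeasurable u))).2 ?_
    refine (hu.2.add ((Lp.memLp u).integrable_sq.const_mul c)).congr ?_
    filter_upwards [s_sq] with x s_sq_x
    rw [Pi.add_apply, Pi.mul_apply, mul_pow, s_sq_x]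
    ring
  have toLp_ae_eq := memLp_mul.coeFn_toLp
  exact ⟨.mk u g memLp_mul.toLp hg toLp_ae_eq, embedding_mk _ _, weakDeriv_mk _ _⟩

lemma formSpace_inner_eq_integral (s_sq : ∀ᵐ x, s x ^ 2 = V x + c) (k l : FormSpace s) :
    inner ℝ k l = (∫ x, k.weakDeriv x * l.weakDeriv x)
      + (∫ x, V x * (embedding s k x * embedding s l x))
      + (c + 1) * inner ℝ (embedding s k) (embedding s l) := by
  have inner_weighted : inner ℝ k.weighted l.weighted
      = (∫ x, V x * (embedding s k x * embedding s l x))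
        + c * inner ℝ (embedding s k) (embedding s l) := by
    rw [L2_inner_eq_integral, L2_inner_eq_integral, ← integral_const_mul,
      ← integral_add _ ((integrable_mul_L2 _ _).const_mul _)]
    · refine integral_congr_ae ?_
      filter_upwards [k.weighted_ae_eq, l.weighted_ae_eq, s_sq] with x k_x l_x s_sq_x
      rw [k_x, l_x]
      linear_combination embedding s k x * embedding s l x * s_sq_x
    · exact integrable_potential_mul (Lp.aestronglyMeasurable _) (Lp.aestronglyMeasurable _)
        (embedding_mem_formDomain s_sq k).2 (embedding_mem_formDomain s_sq l).2
  rw [inner_eq, inner_weighted, L2_inner_eq_integral k.weakDeriv]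
  ring

lemma eigenspace_eq_formEigenspace (s_meas : AEStronglyMeasurable s)
    (s_sq : ∀ᵐ x, s x ^ 2 = V x + c) (μ : ℝ) :
    eigenspace V μ = formEigenspace (embedding s) (μ + (c + 1)) := by
  have integral_smul_mul (u v : L2) : ∫ x, (μ • u : L2) x * v x = μ * inner ℝ u v := by
    rw [← L2_inner_eq_integral, real_inner_smul_left]
  have weak_eigen_iff (k l : FormSpace s) :
      (∫ x, k.weakDeriv x * l.weakDeriv x) + ∫ x, V x * (embedding s k x * embedding s l x)
          = ∫ x, (μ • embedding s k : L2) x * embedding s l x ↔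
        inner ℝ k l = (μ + (c + 1)) * inner ℝ (embedding s k) (embedding s l) := by
    rw [formSpace_inner_eq_integral s_sq, integral_smul_mul, add_mul μ, add_left_inj]
  ext u
  constructor
  · rintro ⟨hu, g, hg, weak_eigen⟩
    obtain ⟨k, rfl, rfl⟩ := exists_formSpace_of_mem_formDomain s_meas s_sq hu hg
    exact ⟨k, rfl, fun l => (weak_eigen_iff k l).1 <|
      weak_eigen _ (embedding_mem_formDomain s_sq l) _ l.isWeakDeriv⟩
  · rintro ⟨k, rfl, inner_k⟩
    refine ⟨embedding_mem_formDomain s_sq k, k.weakDeriv, k.isWeakDeriv, fun v hv h hh => ?_⟩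
    obtain ⟨l, rfl, rfl⟩ := exists_formSpace_of_mem_formDomain s_meas s_sq hv hh
    exact (weak_eigen_iff k l).2 (inner_k l)

end Potential

/-! ### The harmonic oscillator -/

lemma ladder_operator_sq_normHermitePoly (n : ℕ) :
    derivative (derivative (normHermitePoly n) - X * normHermitePoly n)
        - X * (derivative (normHermitePoly n) - X * normHermitePoly n)
      = X * (X * normHermitePoly n) - (2 * (n : ℝ) + 1) • normHermitePoly n := by
  have hermite_ode := congrArg derivative (ladder_smul_normHermitePoly_succ n)
  rw [derivative_smul, derivative_normHermitePoly_succ, smul_smul, ← sq, ladder_sq, derivative_sub,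
    derivative_smul, derivative_mul, derivative_X, one_mul] at hermite_ode
  rw [derivative_sub, derivative_mul, derivative_X, one_mul]
  simp only [smul_eq_C_mul, C_mul, C_add, C_ofNat, C_1] at hermite_ode ⊢
  linear_combination hermite_ode

lemma gaussPolyL2_X_mul (p : ℝ[X]) :
    gaussPolyL2 (X * p) =ᵐ[volume] fun x => x * gaussPolyL2 p x := by
  filter_upwards [coeFn_gaussPolyL2 (X * p), coeFn_gaussPolyL2 p] with x X_mul_p_x p_x
  rw [X_mul_p_x, p_x, gaussPoly_X_mul]

/-- The `n`-th Hermite function as an element of the form space of the harmonic oscillator. -/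
def hermiteForm (n : ℕ) : FormSpace id :=
  .mk (gaussPolyL2 (normHermitePoly n))
    (gaussPolyL2 (derivative (normHermitePoly n) - X * normHermitePoly n))
    (gaussPolyL2 (X * normHermitePoly n)) (isWeakDeriv_gaussPolyL2 _) (gaussPolyL2_X_mul _)

lemma embedding_hermiteForm (n : ℕ) : embedding id (hermiteForm n) = hermiteL2 n :=
  embedding_mk _ _

lemma inner_hermiteForm (n : ℕ) (k : FormSpace id) :
    inner ℝ (hermiteForm n) k = (2 * (n : ℝ) + 2) * inner ℝ (hermiteL2 n) (embedding id k) := by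
  have inner_weakDeriv := k.isWeakDeriv.inner_gaussPolyL2
    (derivative (normHermitePoly n) - X * normHermitePoly n)
  rw [ladder_operator_sq_normHermitePoly, map_sub, map_smul, inner_sub_left,
    real_inner_smul_left] at inner_weakDeriv
  have inner_weighted : inner ℝ (gaussPolyL2 (X * normHermitePoly n)) k.weighted
      = inner ℝ (gaussPolyL2 (X * (X * normHermitePoly n))) (embedding id k) := by
    rw [inner_gaussPolyL2, inner_gaussPolyL2]
    refine integral_congr_ae ?_
    filter_upwards [k.weighted_ae_eq] with x weighted_x
    rw [weighted_x, gaussPoly_X_mul (X * _), id, mul_assoc, mul_left_comm]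
  rw [inner_eq, hermiteForm, embedding_mk, weakDeriv_mk, weighted_mk, inner_weighted, hermiteL2]
  linarith only [inner_weakDeriv]

lemma hermiteL2_mem_formEigenspace (n : ℕ) :
    hermiteL2 n ∈ formEigenspace (embedding id) (2 * (n : ℝ) + 2) :=
  ⟨hermiteForm n, embedding_hermiteForm n, inner_hermiteForm n⟩

lemma norm_hermiteForm_sq (n : ℕ) : ‖hermiteForm n‖ ^ 2 = 2 * (n : ℝ) + 2 := by
  rw [← real_inner_self_eq_norm_sq, inner_hermiteForm, embedding_hermiteForm,
    real_inner_self_eq_norm_sq, orthonormal_hermiteL2.1, one_pow, mul_one]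

lemma isCompactOperator_embedding_id : IsCompactOperator (embedding id) := by
  refine isCompactOperator_of_tendsto_cofinite (w := hermiteBasis)
    (Λ := fun n : ℕ => 2 * (n : ℝ) + 2) (fun n => ?_) ?_
  · rw [coe_hermiteBasis]
    exact hermiteL2_mem_formEigenspace n
  · rw [Nat.cofinite_eq_atTop]
    exact tendsto_atTop_add_const_right _ _
      (tendsto_natCast_atTop_atTop.const_mul_atTop two_pos)

lemma isCompactOperator_embedding {s : ℝ → ℝ} (abs_le : ∀ᵐ x, |x| ≤ |s x|) :
    IsCompactOperator (embedding s) := by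
  refine isCompactOperator_of_forall_exists_norm_le isCompactOperator_embedding_id fun k => ?_
  have norm_mul_le : ∀ᵐ x, ‖x * embedding s k x‖ ≤ ‖k.weighted x‖ := by
    filter_upwards [abs_le, k.weighted_ae_eq] with x abs_le_x weighted_x
    rw [weighted_x, norm_mul, norm_mul]
    exact mul_le_mul_of_nonneg_right abs_le_x (norm_nonneg _)
  have memLp_mul : MemLp (fun x => x * embedding s k x) 2 := (Lp.memLp k.weighted).mono
    (continuous_id.aestronglyMeasurable.mul (Lp.aestronglyMeasurable _)) norm_mul_le
  have norm_toLp_le : ‖memLp_mul.toLp‖ ≤ ‖k.weighted‖ := Lp.norm_le_norm_of_ae_le <| by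
    filter_upwards [memLp_mul.coeFn_toLp, norm_mul_le] with x toLp_x norm_le_x
    rwa [toLp_x]
  refine ⟨.mk (embedding s k) k.weakDeriv memLp_mul.toLp k.isWeakDeriv memLp_mul.coeFn_toLp,
    rfl, le_of_sq_le_sq ?_ (norm_nonneg _)⟩
  rw [norm_sq_eq, norm_sq_eq k]
  simp only [embedding_mk, weakDeriv_mk, weighted_mk]
  gcongr

/-! ### Eigenvalue sequences and form spaces -/

section EigenvalueSequence

variable {V s : ℝ → ℝ} {c : ℝ}

lemma denseRange_embedding (s_meas : AEStronglyMeasurable s) (s_sq : ∀ᵐ x, s x ^ 2 = V x + c)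
    (hermite_mem : ∀ n, hermiteL2 n ∈ formDomain V) : DenseRange (embedding s) := by
  have dense_span := Submodule.dense_iff_topologicalClosure_eq_top.2 hermiteBasis.dense_span
  refine dense_span.mono (s₂ := (embedding s).range) (Submodule.span_le.2 ?_)
  rintro _ ⟨n, rfl⟩
  obtain ⟨g, hg⟩ := (hermite_mem n).1
  obtain ⟨k, hk, -⟩ := exists_formSpace_of_mem_formDomain s_meas s_sq (hermite_mem n) hg
  exact ⟨k, by rw [coe_hermiteBasis]; exact hk⟩

lemma isEigenvalueSequence_iff (s_meas : AEStronglyMeasurable s) (s_sq : ∀ᵐ x, s x ^ 2 = V x + c)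
    (hJ : IsCompactOperator (embedding s)) {lam : ℕ → ℝ} : IsEigenvalueSequence V lam ↔
      IsEnumeration (fun Λ => Module.finrank ℝ (formEigenspace (embedding s) Λ))
        fun k => lam k + (c + 1) := by
  have finrank_eq : (fun μ => Module.finrank ℝ (formEigenspace (embedding s) (μ + (c + 1))))
      = fun μ => Module.finrank ℝ (eigenspace V μ) := funext fun μ => by
    rw [eigenspace_eq_formEigenspace s_meas s_sq]
  rw [IsEnumeration.add_const_iff, finrank_eq]
  refine ⟨fun h => ⟨h.monotone, h.tendsto, h.multiplicity⟩,
    fun h => ⟨h.monotone, h.tendsto, fun μ => ?_, h.multiplicity⟩⟩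
  rw [eigenspace_eq_formEigenspace s_meas s_sq]
  exact finiteDimensional_formEigenspace hJ _

end EigenvalueSequence

/-! ### The perturbed oscillator -/

lemma integrable_sq_mul_hermiteFun_sq (n : ℕ) : Integrable fun x => x ^ 2 * hermiteFun n x ^ 2 := by
  refine (integrable_gaussPoly_mul (X * normHermitePoly n) (X * normHermitePoly n)).congr
    (Eventually.of_forall fun x => ?_)
  simp only [gaussPoly_X_mul, hermiteFun]
  ring

lemma energy_hermiteForm (n : ℕ) :
    (∫ x, (hermiteForm n).weakDeriv x * (hermiteForm n).weakDeriv x)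
      + ∫ x, x ^ 2 * hermiteFun n x ^ 2 = lam0 n := by
  have norm_sq := formSpace_inner_eq_integral (V := fun x => x ^ 2) (s := id) (c := 0)
    (Eventually.of_forall fun x => (add_zero (x ^ 2)).symm) (hermiteForm n) (hermiteForm n)
  rw [embedding_hermiteForm, real_inner_self_eq_norm_sq, real_inner_self_eq_norm_sq,
    norm_hermiteForm_sq, orthonormal_hermiteL2.1] at norm_sq
  have potential_eq : ∫ x, x ^ 2 * (hermiteL2 n x * hermiteL2 n x)
      = ∫ x, x ^ 2 * hermiteFun n x ^ 2 := by
    refine integral_congr_ae ?_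
    filter_upwards [coeFn_hermiteL2 n] with x hermite_x
    rw [hermite_x, sq (hermiteFun n x)]
  rw [potential_eq] at norm_sq
  rw [lam0]
  linarith

section Perturbed

variable {q : ℝ → ℝ} {c : ℝ}

lemma hermiteL2_mem_formDomain (hq : Integrable q) (n : ℕ) :
    hermiteL2 n ∈ formDomain fun x => x ^ 2 + q x := by
  refine ⟨⟨_, isWeakDeriv_gaussPolyL2 _⟩, ?_⟩
  refine ((integrable_sq_mul_hermiteFun_sq n).add (integrable_mul_hermiteFun_sq hq n)).congr ?_
  filter_upwards [coeFn_hermiteL2 n] with x hermite_x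
  rw [Pi.add_apply, hermite_x, add_mul]

/-- The square root of the shifted potential `x² + q(x) + c`, used as the weight of the form space
of the perturbed oscillator. -/
def formWeight (q : ℝ → ℝ) (c x : ℝ) : ℝ := √(x ^ 2 + q x + c)

lemma aestronglyMeasurable_formWeight (hq : Integrable q) :
    AEStronglyMeasurable (formWeight q c) :=
  Real.continuous_sqrt.comp_aestronglyMeasurable <|
    ((continuous_pow 2).aestronglyMeasurable.add hq.aestronglyMeasurable).add_const c

lemma formWeight_sq (q_add_nonneg : ∀ᵐ x, 0 ≤ q x + c) :
    ∀ᵐ x, formWeight q c x ^ 2 = x ^ 2 + q x + c := by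
  filter_upwards [q_add_nonneg] with x hx
  exact Real.sq_sqrt (by linarith [sq_nonneg x])

lemma abs_le_abs_formWeight (q_add_nonneg : ∀ᵐ x, 0 ≤ q x + c) :
    ∀ᵐ x, |x| ≤ |formWeight q c x| := by
  filter_upwards [q_add_nonneg, formWeight_sq q_add_nonneg] with x hx weight_sq
  exact sq_le_sq.1 (by linarith)

lemma exists_hermiteL2_lift (hq : Integrable q) (q_add_nonneg : ∀ᵐ x, 0 ≤ q x + c) (n : ℕ) :
    ∃ k : FormSpace (formWeight q c), embedding _ k = hermiteL2 n ∧
      ‖k‖ ^ 2 = lam0 n + (∫ x, q x * hermiteFun n x ^ 2) + (c + 1) := by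
  have hermite_isWeakDeriv := (hermiteForm n).isWeakDeriv
  rw [embedding_hermiteForm] at hermite_isWeakDeriv
  obtain ⟨k, embedding_k, weakDeriv_k⟩ := exists_formSpace_of_mem_formDomain
    (aestronglyMeasurable_formWeight hq) (formWeight_sq q_add_nonneg)
    (hermiteL2_mem_formDomain hq n) hermite_isWeakDeriv
  have potential_eq : ∫ x, (x ^ 2 + q x) * (hermiteL2 n x * hermiteL2 n x)
      = (∫ x, x ^ 2 * hermiteFun n x ^ 2) + ∫ x, q x * hermiteFun n x ^ 2 := by
    rw [← integral_add (integrable_sq_mul_hermiteFun_sq n) (integrable_mul_hermiteFun_sq hq n)]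
    refine integral_congr_ae ?_
    filter_upwards [coeFn_hermiteL2 n] with x hermite_x
    rw [hermite_x, ← sq, add_mul]
  refine ⟨k, embedding_k, ?_⟩
  rw [← real_inner_self_eq_norm_sq, formSpace_inner_eq_integral (formWeight_sq q_add_nonneg),
    embedding_k, weakDeriv_k, potential_eq, ← add_assoc, energy_hermiteForm,
    real_inner_self_eq_norm_sq, orthonormal_hermiteL2.1, one_pow, mul_one]

lemma exists_isEigenvalueSequence (hq : Integrable q) (q_add_nonneg : ∀ᵐ x, 0 ≤ q x + c) :
    ∃ lam, IsEigenvalueSequence (fun x => x ^ 2 + q x) lam := by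
  have weight_meas := aestronglyMeasurable_formWeight (c := c) hq
  have weight_sq := formWeight_sq q_add_nonneg
  have compact := isCompactOperator_embedding (abs_le_abs_formWeight q_add_nonneg)
  obtain ⟨Λ, hΛ⟩ := exists_isEnumeration_formEigenspace compact
    (denseRange_embedding weight_meas weight_sq (hermiteL2_mem_formDomain hq))
    fun _ => not_finite_iff_infinite.2 inferInstance orthonormal_hermiteL2.linearIndependent.finite
  refine ⟨fun k => Λ k - (c + 1), (isEigenvalueSequence_iff weight_meas weight_sq compact).2 ?_⟩
  simpa only [sub_add_cancel] using hΛ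

lemma sum_eigenvalue_le (hq : Integrable q) (q_add_nonneg : ∀ᵐ x, 0 ≤ q x + c) {lam : ℕ → ℝ}
    (hlam : IsEigenvalueSequence (fun x => x ^ 2 + q x) lam) (n : ℕ) :
    ∑ k ∈ Finset.range n, lam k
      ≤ ∑ k ∈ Finset.range n, (lam0 k + ∫ x, q x * hermiteFun k x ^ 2) := by
  have weight_meas := aestronglyMeasurable_formWeight (c := c) hq
  have weight_sq := formWeight_sq q_add_nonneg
  have compact := isCompactOperator_embedding (abs_le_abs_formWeight q_add_nonneg)
  choose p embedding_p norm_p_sq using exists_hermiteL2_lift hq q_add_nonneg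
  have variational := sum_range_le_sum_norm_sq compact
    (denseRange_embedding weight_meas weight_sq (hermiteL2_mem_formDomain hq))
    ((isEigenvalueSequence_iff weight_meas weight_sq compact).1 hlam) (p := fun i : Fin n => p i)
    (funext (fun i : Fin n => embedding_p i) ▸ orthonormal_hermiteL2.comp _ Fin.val_injective)
  simp only [norm_p_sq] at variational
  rw [Fin.sum_univ_eq_sum_range fun i => lam0 i + (∫ x, q x * hermiteFun i x ^ 2) + (c + 1),
    Finset.sum_add_distrib, Finset.sum_add_distrib (g := fun _ => c + 1)] at variational
  exact le_of_add_le_add_right variational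

end Perturbed

lemma sum_integral_mul_hermiteFun_sq_le_of_add_exp_nonneg {q : ℝ → ℝ} {q_m : ℝ} (hq : Integrable q)
    (q_add_nonneg : ∀ᵐ x : ℝ, 0 ≤ q x + q_m * Real.exp (-x ^ 2)) (n : ℕ) :
    ∑ k ∈ Finset.range (n + 1), ∫ x, q x * hermiteFun k x ^ 2
      ≤ omega n / Real.pi * (∫ x, q x) + epsilon n * (q_m / √Real.pi) := by
  have hg : Integrable fun x => q_m * Real.exp (-x ^ 2) := integrable_exp_neg_sq.const_mul q_m
  have gauss_sum : ∑ k ∈ Finset.range (n + 1), ∫ x, q_m * Real.exp (-x ^ 2) * hermiteFun k x ^ 2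
      = q_m * (√2 * (Real.Gamma (n + 3 / 2) / Real.Gamma (n + 1)) / √Real.pi) := by
    simp only [mul_assoc, integral_const_mul]
    rw [← Finset.mul_sum, sum_integral_exp_mul_hermiteFun_sq]
  have sum_le := sum_integral_mul_hermiteFun_sq_le (hq.add hg) q_add_nonneg n
  simp only [Pi.add_apply, add_mul] at sum_le
  simp only [integral_add hq hg, integral_add (integrable_mul_hermiteFun_sq hq _)
    (integrable_mul_hermiteFun_sq hg _), Finset.sum_add_distrib, gauss_sum, integral_const_mul,
    integral_exp_neg_sq] at sum_le
  have sqrt_pi_div_pi : √Real.pi / Real.pi = 1 / √Real.pi := Real.sqrt_div_self'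
  rw [epsilon]
  linear_combination sum_le + omega n * q_m * sqrt_pi_div_pi

lemma sum_inv_sqrt_lam0_mul (n : ℕ) (Q : ℝ) :
    ∑ k ∈ Finset.range (n + 1), 1 / (Real.pi * √(lam0 k)) * Q
      = omega n / Real.pi * Q - chi n / Real.pi * Q := by
  simp only [← Finset.sum_mul, one_div, mul_inv, ← Finset.mul_sum]
  simp only [omega, one_div]
  ring

end PerturbedOscillator

end

theorem theorem4p1_general {q : ℝ → ℝ} {q_m : ℝ} (hq : Integrable q)
    (q_add_nonneg : ∀ᵐ x : ℝ, 0 ≤ q x + q_m * Real.exp (-x ^ 2)) :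
    (∃ lam : ℕ → ℝ, PerturbedOscillator.IsEigenvalueSequence (fun x => x ^ 2 + q x) lam) ∧
      ∀ lam : ℕ → ℝ, PerturbedOscillator.IsEigenvalueSequence (fun x => x ^ 2 + q x) lam →
        ∀ n : ℕ,
          ∑ k ∈ Finset.range (n + 1),
              (lam k - PerturbedOscillator.lam0 k
                - 1 / (Real.pi * √(PerturbedOscillator.lam0 k)) * ∫ x, q x)
            ≤ PerturbedOscillator.chi n / Real.pi * (∫ x, q x)
              + PerturbedOscillator.epsilon n * (q_m / √Real.pi) := by
  have q_add_abs_nonneg : ∀ᵐ x, 0 ≤ q x + |q_m| := by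
    filter_upwards [q_add_nonneg] with x hx
    have exp_le_one : Real.exp (-x ^ 2) ≤ 1 := Real.exp_le_one_iff.2 (neg_nonpos.2 (sq_nonneg x))
    nlinarith [le_abs_self q_m, abs_nonneg q_m, Real.exp_pos (-x ^ 2)]
  refine ⟨PerturbedOscillator.exists_isEigenvalueSequence hq q_add_abs_nonneg, fun lam hlam n => ?_⟩
  have variational := PerturbedOscillator.sum_eigenvalue_le hq q_add_abs_nonneg hlam (n + 1)
  have perturbation :=
    PerturbedOscillator.sum_integral_mul_hermiteFun_sq_le_of_add_exp_nonneg hq q_add_nonneg n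
  rw [Finset.sum_add_distrib] at variational
  rw [Finset.sum_sub_distrib, Finset.sum_sub_distrib, PerturbedOscillator.sum_inv_sqrt_lam0_mul]
  linarith

theorem theorem4p1 :
    (∀ (q : ℝ → ℝ) (q_m : ℝ), MeasureTheory.Integrable q MeasureTheory.volume → 0 ≤ q_m →
      (∀ᵐ x : ℝ, 0 ≤ q x + q_m * Real.exp (-x ^ 2)) →
        (∃ lam : ℕ → ℝ, PerturbedOscillator.IsEigenvalueSequence (fun x => x ^ 2 + q x) lam) ∧
        ∀ lam : ℕ → ℝ, PerturbedOscillator.IsEigenvalueSequence (fun x => x ^ 2 + q x) lam →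
          ∀ n : ℕ,
            ∑ k ∈ Finset.range (n + 1),
                (lam k - PerturbedOscillator.lam0 k
                  - 1 / (Real.pi * √(PerturbedOscillator.lam0 k)) * ∫ x, q x)
              ≤ PerturbedOscillator.chi n / Real.pi * (∫ x, q x)
                + PerturbedOscillator.epsilon n * (q_m / √Real.pi)) ∧
    (∀ n : ℕ, 0 ≤ PerturbedOscillator.epsilon n) ∧
    (fun n : ℕ => PerturbedOscillator.epsilon n)
      =O[Filter.atTop] (fun n : ℕ => 1 / √(n : ℝ)) := by
  exact ⟨fun _ _ hq _ q_add_nonneg => theorem4p1_general hq q_add_nonneg,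
    PerturbedOscillator.epsilon_nonneg, PerturbedOscillator.epsilon_isBigO⟩
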